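/- **Conventions.** An operator space is a complex Banach space with norms on all matrix spaces over it satisfying Ruan's axioms. All operator spaces, algebras and modules below carry a (possibly trivial) $\mathbb{Z}/2$-grading given by a completely isometric linear involution $\gamma$; for a homogeneous element $\gamma(x)=(-1)^{\partial x}x$, and formulas containing $(-1)^{\partial x}$ are extended linearly. An operator algebra is a unital algebra that is an operator space with completely contractive multiplication; an operator module is a unital module that is an operator space with completely contractive action, and an operator $(\mathcal A,\mathcal B)$-bimodule carries commuting actions of both kinds; multiplication and actions respect the gradings. $\tilde\otimes$ is the (completed) Haagerup tensor product, and for a right operator $\mathcal A$-module $X$ and a left operator $\mathcal A$-module $Y$, $X\tilde\otimes_{\mathcal A}Y$ is the quotient of $X\tilde\otimes Y$ by the closed linear span of the elements $xa\otimes y-x\otimes ay$. Put $$\Omega^1(\mathcal A)=\ker\bigl(m:\mathcal A\tilde\otimes\mathcal A\to\mathcal A,\ m(a\otimes b)=(-1)^{\partial b}ab\bigr),\qquad da=1\otimes a-(-1)^{\partial a}a\otimes 1 .$$ A *universal connection* on a right operator $\mathcal A$-module $P$ is a completely bounded linear map $\nabla:P\to P\tilde\otimes_{\mathcal A}\Omega^1(\mathcal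 A)$ with $\nabla(pa)=\nabla(p)a+(-1)^{\partial p}p\otimes da$. If $P'$ is an operator $(\mathcal A,\mathcal B)$-bimodule with a universal connection $\nabla':P'\to P'\tilde\otimes_{\mathcal B}\Omega^1(\mathcal B)$, let $\delta(a)=\nabla' a-(-1)^{\partial a}a\nabla'$ for $a\in\mathcal A$, let $j_\delta:\Omega^1(\mathcal A)\to \mathrm{Hom}_{\mathcal B}(P',P'\tilde\otimes_{\mathcal B}\Omega^1(\mathcal B))$ be the bimodule map with $j_\delta(da)=\delta(a)$, and let $\nabla_\delta=(1\otimes j_\delta)\circ\nabla$. The *product connection* $\nabla\tilde\otimes_{\mathcal A}\nabla'$ is the universal connection on the right $\mathcal B$-module $P\tilde\otimes_{\mathcal A}P'$ given by $$(\nabla\tilde\otimes_{\mathcal A}\nabla')(p\otimes p')=(-1)^{\partial p}p\otimes\nabla'(p')+\nabla_\delta(p)p',$$ where $P\tilde\otimes_{\mathcal A}(P'\tilde\otimes_{\mathcal B}\Omega^1(\mathcal B))$ is identified with $(P\tilde\otimes_{\mathcal A}P')\tilde\otimes_{\mathcal B}\Omega^1(\mathcal B)$. **Theorem.** Taking product connections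 is associative. Let $\mathcal A,\mathcal B,\mathcal C$ be operator algebras, $P$ a right operator $\mathcal A$-module, $P'$ an operator $(\mathcal A,\mathcal B)$-bimodule and $P''$ an operator $(\mathcal B,\mathcal C)$-bimodule (for instance projective rigged ones), with universal connections $\nabla,\nabla',\nabla''$ (for the right actions of $\mathcal A,\mathcal B,\mathcal C$ respectively). Then $p\otimes(p'\otimes p'')\mapsto(p\otimes p')\otimes p''$ defines a completely isometric, grading-preserving isomorphism of right $\mathcal C$-modules $$\Phi:P\tilde\otimes_{\mathcal A}(P'\tilde\otimes_{\mathcal B}P'')\xrightarrow{\ \sim\ }(P\tilde\otimes_{\mathcal A}P')\tilde\otimes_{\mathcal B}P'',$$ and $\Phi$ intertwines the two product connections: $$\bigl((\nabla\tilde\otimes_{\mathcal A}\nabla')\tilde\otimes_{\mathcal B}\nabla''\bigr)\circ\Phi=(\Phi\otimes 1_{\Omega^1(\mathcal C)})\circ\bigl(\nabla\tilde\otimes_{\mathcal A}(\nabla'\tilde\otimes_{\mathcal B}\nabla'')\bigr).$$ -/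

import Mathlib

set_option linter.unusedSectionVars false
set_option linter.unusedSimpArgs false

noncomputable section

namespace OpMod

open scoped TensorProduct Matrix.Norms.L2Operator

/-! ## Matrices with entries in a vector space -/

section MatrixCalculus

variable {X Y Z W V : Type*}
  [AddCommGroup X] [Module ℂ X] [AddCommGroup Y] [Module ℂ Y]
  [AddCommGroup Z] [Module ℂ Z] [AddCommGroup W] [Module ℂ W] [AddCommGroup V] [Module ℂ V]
variable {m n k l : Type} [Fintype m] [Fintype n] [Fintype k] [Fintype l]

/-- The amplification of a bilinear map `β` to matrices: the "matrix product"
`(x, y) ↦ (∑ l, β (x i l) (y l j))`. -/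
def mmul (β : X →ₗ[ℂ] Y →ₗ[ℂ] Z) (x : Matrix m k X) (y : Matrix k n Y) : Matrix m n Z :=
  Matrix.of fun i j => ∑ s, β (x i s) (y s j)

theorem mmul_assoc {β₁ : X →ₗ[ℂ] Y →ₗ[ℂ] W} {β₂ : W →ₗ[ℂ] Z →ₗ[ℂ] V}
    {U : Type*} [AddCommGroup U] [Module ℂ U]
    {β₃ : Y →ₗ[ℂ] Z →ₗ[ℂ] U} {β₄ : X →ₗ[ℂ] U →ₗ[ℂ] V}
    (h : ∀ x y z, β₂ (β₁ x y) z = β₄ x (β₃ y z))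
    (x : Matrix m k X) (y : Matrix k l Y) (z : Matrix l n Z) :
    mmul β₂ (mmul β₁ x y) z = mmul β₄ x (mmul β₃ y z) := by
  ext i j
  simp only [mmul, Matrix.of_apply, map_sum, LinearMap.sum_apply, h]
  exact Finset.sum_comm

theorem mmul_map {β : X →ₗ[ℂ] Y →ₗ[ℂ] Z} {β' : X →ₗ[ℂ] Y →ₗ[ℂ] W} {f : Z → W}
    (f0 : f 0 = 0) (fadd : ∀ a b, f (a + b) = f a + f b)
    (h : ∀ x y, f (β x y) = β' x y) (x : Matrix m k X) (y : Matrix k n Y) :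
    (mmul β x y).map f = mmul β' x y := by
  ext i j
  let F : Z →+ W := ⟨⟨f, f0⟩, fadd⟩
  change F _ = _
  simp only [mmul, Matrix.of_apply, map_sum]
  exact Finset.sum_congr rfl fun s _ => h _ _

theorem mmul_fromCols_fromRows (β : X →ₗ[ℂ] Y →ₗ[ℂ] Z) (x : Matrix m k X) (x' : Matrix m l X)
    (y : Matrix k n Y) (y' : Matrix l n Y) :
    mmul β (Matrix.fromCols x x') (Matrix.fromRows y y') = mmul β x y + mmul β x' y' := by
  ext i j
  simp [mmul]

theorem mmul_blocks (β : X →ₗ[ℂ] Y →ₗ[ℂ] Z) {m' n' : Type} [Fintype m'] [Fintype n']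
    (x : Matrix m k X) (x' : Matrix m' l X) (y : Matrix k n Y) (y' : Matrix l n' Y) :
    mmul β (Matrix.fromBlocks x 0 0 x') (Matrix.fromBlocks y 0 0 y') =
      Matrix.fromBlocks (mmul β x y) 0 0 (mmul β x' y') := by
  ext (i | i) (j | j) <;> simp [mmul]

/-- The `1 × 1` matrix with entry `x`. -/
def unit (x : X) : Matrix Unit Unit X := Matrix.of fun _ _ => x

@[simp] theorem unit_apply (x : X) (i j : Unit) : unit x i j = x := rfl

end MatrixCalculus

/-! ## Norms of some scalar matrices -/

section Scalar

variable {m n : Type} [Fintype m] [Fintype n] [DecidableEq m] [DecidableEq n]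

theorem norm_le_of_mul_conjTranspose {α : Matrix m n ℂ} {c : ℝ} (hc : 0 ≤ c)
    (h : α * α.conjTranspose = Matrix.diagonal fun _ => (c : ℂ)) : ‖α‖ ≤ √c := by
  apply Real.le_sqrt_of_sq_le
  have h1 := Matrix.l2_opNorm_conjTranspose_mul_self α.conjTranspose
  rw [Matrix.conjTranspose_conjTranspose, h, Matrix.l2_opNorm_conjTranspose,
    Matrix.l2_opNorm_diagonal] at h1
  rw [sq, ← h1]
  refine (pi_norm_le_iff_of_nonneg hc).2 fun i => ?_
  simp [abs_of_nonneg hc]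

theorem norm_le_of_conjTranspose_mul {α : Matrix m n ℂ} {c : ℝ} (hc : 0 ≤ c)
    (h : α.conjTranspose * α = Matrix.diagonal fun _ => (c : ℂ)) : ‖α‖ ≤ √c := by
  rw [← Matrix.l2_opNorm_conjTranspose α]
  exact norm_le_of_mul_conjTranspose hc (by simpa using h)

/-- The row vector `e_i`. -/
def rowE (i : m) : Matrix Unit m ℂ := Matrix.of fun _ j => if j = i then 1 else 0
/-- The column vector `e_i`. -/
def colE (i : m) : Matrix m Unit ℂ := Matrix.of fun j _ => if j = i then 1 else 0

theorem norm_rowE (i : m) : ‖rowE i‖ ≤ 1 := by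
  rw [← Real.sqrt_one]
  apply norm_le_of_mul_conjTranspose zero_le_one
  ext a b
  simp [rowE, Matrix.mul_apply, Matrix.diagonal_apply]

theorem norm_colE (i : m) : ‖colE i‖ ≤ 1 := by
  rw [← Real.sqrt_one]
  apply norm_le_of_conjTranspose_mul zero_le_one
  ext a b
  simp [colE, Matrix.mul_apply, Matrix.diagonal_apply]

theorem norm_rowPair (a b : ℝ) :
    ‖(Matrix.fromCols (Matrix.diagonal fun _ : m => (a : ℂ)) (Matrix.diagonal fun _ => (b : ℂ)) :
      Matrix m (m ⊕ m) ℂ)‖ ≤ √(a ^ 2 + b ^ 2) := by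
  apply norm_le_of_mul_conjTranspose (by positivity)
  rw [Matrix.conjTranspose_fromCols_eq_fromRows_conjTranspose, Matrix.fromCols_mul_fromRows,
    Matrix.diagonal_conjTranspose, Matrix.diagonal_conjTranspose, Matrix.diagonal_mul_diagonal,
    Matrix.diagonal_mul_diagonal, Matrix.diagonal_add]
  congr 1
  ext i
  simp [sq]

theorem norm_colPair (a b : ℝ) :
    ‖(Matrix.fromRows (Matrix.diagonal fun _ : m => (a : ℂ)) (Matrix.diagonal fun _ => (b : ℂ)) :
      Matrix (m ⊕ m) m ℂ)‖ ≤ √(a ^ 2 + b ^ 2) := by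
  apply norm_le_of_conjTranspose_mul (by positivity)
  rw [Matrix.conjTranspose_fromRows_eq_fromCols_conjTranspose, Matrix.fromCols_mul_fromRows,
    Matrix.diagonal_conjTranspose, Matrix.diagonal_conjTranspose, Matrix.diagonal_mul_diagonal,
    Matrix.diagonal_mul_diagonal, Matrix.diagonal_add]
  congr 1
  ext i
  simp [sq]

end Scalar

/-! ## Operator spaces -/

/-- A family of seminorms on all matrices over `V` that satisfies Ruan's axioms.  The matrices are
indexed by arbitrary finite types; `smul_left_le` and `smul_right_le` make the value independent of
the names of the indices and make the reverse of `blocks_le` automatic. The scalar matrices carry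
the operator norm of `ℓ²`. -/
structure MatrixSeminorm (V : Type*) [AddCommGroup V] [Module ℂ V] where
  /-- The seminorm of a matrix. -/
  toFun : ∀ {m n : Type} [Fintype m] [Fintype n], Matrix m n V → ℝ
  add_le : ∀ {m n : Type} [Fintype m] [Fintype n] (v w : Matrix m n V),
    toFun (v + w) ≤ toFun v + toFun w
  smul_left_le : ∀ {m k n : Type} [Fintype m] [Fintype k] [Fintype n] [DecidableEq k]
    (α : Matrix m k ℂ) (v : Matrix k n V), toFun (mmul (LinearMap.lsmul ℂ V) α v) ≤ ‖α‖ * toFun v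
  smul_right_le : ∀ {m k n : Type} [Fintype m] [Fintype k] [Fintype n] [DecidableEq n]
    (v : Matrix m k V) (α : Matrix k n ℂ),
    toFun (mmul (LinearMap.lsmul ℂ V).flip v α) ≤ toFun v * ‖α‖
  blocks_le : ∀ {m n m' n' : Type} [Fintype m] [Fintype n] [Fintype m'] [Fintype n']
    (v : Matrix m n V) (w : Matrix m' n' V),
    toFun (Matrix.fromBlocks v 0 0 w) ≤ max (toFun v) (toFun w)

namespace MatrixSeminorm

variable {V : Type*} [AddCommGroup V] [Module ℂ V] (ν : MatrixSeminorm V)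
variable {m n k l : Type} [Fintype m] [Fintype n] [Fintype k] [Fintype l]

theorem smul_le (c : ℂ) (v : Matrix m n V) : ν.toFun (c • v) ≤ ‖c‖ * ν.toFun v := by
  classical
  have h := ν.smul_left_le (Matrix.diagonal fun _ : m => c) v
  have e : mmul (LinearMap.lsmul ℂ V) (Matrix.diagonal fun _ : m => c) v = c • v := by
    ext i j
    simp only [mmul, Matrix.of_apply, LinearMap.lsmul_apply, Matrix.smul_apply]
    rw [Finset.sum_eq_single i] <;> simp +contextual [Matrix.diagonal_apply, eq_comm]
  rw [e] at h
  by_cases hm : Nonempty m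
  · simpa [Matrix.l2_opNorm_diagonal, pi_norm_const] using h
  · have : IsEmpty m := not_nonempty_iff.1 hm
    have h0 : (0 : Matrix m n V) = v := Subsingleton.elim _ _
    have h1 : (c • v : Matrix m n V) = v := Subsingleton.elim _ _
    have h2 : ν.toFun v ≤ 0 := by
      have := ν.smul_left_le (0 : Matrix m m ℂ) v
      rw [norm_zero, zero_mul] at this
      convert this using 2
      exact Subsingleton.elim _ _
    have h3 : 0 ≤ ν.toFun v := by
      have := ν.add_le v v
      rw [show v + v = v from Subsingleton.elim _ _] at this
      linarith
    rw [h1, le_antisymm h2 h3]; simp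

theorem zero_eq : ν.toFun (0 : Matrix m n V) = 0 := by
  apply le_antisymm
  · simpa using ν.smul_le 0 (0 : Matrix m n V)
  · have := ν.add_le (0 : Matrix m n V) 0
    rw [add_zero] at this
    linarith

theorem neg_eq (v : Matrix m n V) : ν.toFun (-v) = ν.toFun v := by
  have h : ∀ v : Matrix m n V, ν.toFun (-v) ≤ ν.toFun v := fun v => by
    simpa using ν.smul_le (-1) v
  exact le_antisymm (h v) (by simpa using h (-v))

theorem nonneg (v : Matrix m n V) : 0 ≤ ν.toFun v := by
  have := ν.add_le v (-v)
  rw [add_neg_cancel, ν.zero_eq, ν.neg_eq] at this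
  linarith

theorem sub_le (v w : Matrix m n V) : ν.toFun v - ν.toFun w ≤ ν.toFun (v - w) := by
  have := ν.add_le (v - w) w
  rw [sub_add_cancel] at this
  linarith

theorem entry_le (v : Matrix m n V) (i : m) (j : n) : ν.toFun (unit (v i j)) ≤ ν.toFun v := by
  classical
  have h := ν.smul_right_le (mmul (LinearMap.lsmul ℂ V) (rowE i) v) (colE j)
  have e : mmul (LinearMap.lsmul ℂ V).flip (mmul (LinearMap.lsmul ℂ V) (rowE i) v) (colE j) =
      unit (v i j) := by
    ext a b
    simp [mmul, rowE, colE]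
  rw [e] at h
  refine h.trans ?_
  have h2 := ν.smul_left_le (rowE i) v
  have := norm_rowE i
  have := norm_colE j
  have := ν.nonneg v
  have h4 : ‖rowE i‖ * ν.toFun v ≤ ν.toFun v := by nlinarith
  have := ν.nonneg (mmul (LinearMap.lsmul ℂ V) (rowE i) v)
  nlinarith

theorem single_le [DecidableEq m] [DecidableEq n] (i : m) (j : n) (x : V) :
    ν.toFun (Matrix.single i j x) ≤ ν.toFun (unit x) := by
  have h := ν.smul_right_le (mmul (LinearMap.lsmul ℂ V) (colE i) (unit x)) (rowE j)
  have e : mmul (LinearMap.lsmul ℂ V).flip (mmul (LinearMap.lsmul ℂ V) (colE i) (unit x)) (rowE j) =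
      Matrix.single i j x := by
    ext a b
    simp only [mmul, rowE, colE, Matrix.single, Matrix.of_apply]
    by_cases h1 : i = a <;> by_cases h2 : j = b <;> simp [h1, h2, eq_comm]
  rw [e] at h
  refine h.trans ?_
  have h2 := ν.smul_left_le (colE i) (unit x)
  have := norm_rowE j
  have := norm_colE i
  have := ν.nonneg (unit x)
  have h4 : ‖colE i‖ * ν.toFun (unit x) ≤ ν.toFun (unit x) := by nlinarith
  have := ν.nonneg (mmul (LinearMap.lsmul ℂ V) (colE i) (unit x))
  nlinarith

theorem le_sum (v : Matrix m n V) : ν.toFun v ≤ ∑ i, ∑ j, ν.toFun (unit (v i j)) := by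
  classical
  have hs : ∀ {ι : Type} (s : Finset ι) (f : ι → Matrix m n V),
      ν.toFun (∑ i ∈ s, f i) ≤ ∑ i ∈ s, ν.toFun (f i) := fun s f =>
    Finset.le_sum_of_subadditive _ ν.zero_eq.le ν.add_le s f
  conv_lhs => rw [Matrix.matrix_eq_sum_single v]
  exact (hs _ _).trans (Finset.sum_le_sum fun i _ => (hs _ _).trans
    (Finset.sum_le_sum fun j _ => ν.single_le i j _))

theorem fromCols_le {s t : ℝ} (hs : 0 < s) (ht : 0 < t) {v : Matrix m k V} {w : Matrix m l V}
    (hv : ν.toFun v ≤ √s) (hw : ν.toFun w ≤ √t) :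
    ν.toFun (Matrix.fromCols v w) ≤ √(s + t) := by
  classical
  have hs' := Real.sqrt_pos.2 hs
  have ht' := Real.sqrt_pos.2 ht
  have h := ν.smul_left_le
    (Matrix.fromCols (Matrix.diagonal fun _ : m => ((√s : ℝ) : ℂ))
      (Matrix.diagonal fun _ => ((√t : ℝ) : ℂ)))
    (Matrix.fromBlocks ((((√s)⁻¹ : ℝ) : ℂ) • v) 0 0 ((((√t)⁻¹ : ℝ) : ℂ) • w))
  have e : mmul (LinearMap.lsmul ℂ V)
    (Matrix.fromCols (Matrix.diagonal fun _ : m => ((√s : ℝ) : ℂ))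
      (Matrix.diagonal fun _ => ((√t : ℝ) : ℂ)))
    (Matrix.fromBlocks ((((√s)⁻¹ : ℝ) : ℂ) • v) 0 0 ((((√t)⁻¹ : ℝ) : ℂ) • w)) =
      Matrix.fromCols v w := by
    have h1 : ((√s : ℝ) : ℂ) ≠ 0 := by exact_mod_cast hs'.ne'
    have h2 : ((√t : ℝ) : ℂ) ≠ 0 := by exact_mod_cast ht'.ne'
    ext i (j | j) <;>
    · simp [mmul, Matrix.diagonal_apply, smul_smul, h1, h2]
      rw [← Complex.coe_smul, smul_smul, mul_inv_cancel₀ (by assumption), one_smul]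
  rw [e] at h
  refine h.trans ?_
  have h1 := norm_rowPair (m := m) (√s) (√t)
  rw [Real.sq_sqrt hs.le, Real.sq_sqrt ht.le] at h1
  have h2 : ν.toFun (Matrix.fromBlocks ((((√s)⁻¹ : ℝ) : ℂ) • v) 0 0 ((((√t)⁻¹ : ℝ) : ℂ) • w)) ≤ 1 := by
    refine (ν.blocks_le _ _).trans (max_le ?_ ?_) <;>
    · refine (ν.smul_le _ _).trans ?_
      rw [Complex.norm_real, Real.norm_of_nonneg (by positivity), inv_mul_le_iff₀ (by assumption)]
      simpa
  calc _ ≤ √(s + t) * 1 := mul_le_mul h1 h2 (ν.nonneg _) (by positivity)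
    _ = _ := mul_one _

theorem fromRows_le {s t : ℝ} (hs : 0 < s) (ht : 0 < t) {v : Matrix k m V} {w : Matrix l m V}
    (hv : ν.toFun v ≤ √s) (hw : ν.toFun w ≤ √t) :
    ν.toFun (Matrix.fromRows v w) ≤ √(s + t) := by
  classical
  have hs' := Real.sqrt_pos.2 hs
  have ht' := Real.sqrt_pos.2 ht
  have h := ν.smul_right_le
    (Matrix.fromBlocks ((((√s)⁻¹ : ℝ) : ℂ) • v) 0 0 ((((√t)⁻¹ : ℝ) : ℂ) • w))
    (Matrix.fromRows (Matrix.diagonal fun _ : m => ((√s : ℝ) : ℂ))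
      (Matrix.diagonal fun _ => ((√t : ℝ) : ℂ)))
  have e : mmul (LinearMap.lsmul ℂ V).flip
    (Matrix.fromBlocks ((((√s)⁻¹ : ℝ) : ℂ) • v) 0 0 ((((√t)⁻¹ : ℝ) : ℂ) • w))
    (Matrix.fromRows (Matrix.diagonal fun _ : m => ((√s : ℝ) : ℂ))
      (Matrix.diagonal fun _ => ((√t : ℝ) : ℂ))) =
      Matrix.fromRows v w := by
    have h1 : ((√s : ℝ) : ℂ) ≠ 0 := by exact_mod_cast hs'.ne'
    have h2 : ((√t : ℝ) : ℂ) ≠ 0 := by exact_mod_cast ht'.ne'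
    ext (i | i) j <;>
    · simp [mmul, Matrix.diagonal_apply, smul_smul, h1, h2]
      rw [← Complex.coe_smul, smul_smul, mul_inv_cancel₀ (by assumption), one_smul]
  rw [e] at h
  refine h.trans ?_
  have h1 := norm_colPair (m := m) (√s) (√t)
  rw [Real.sq_sqrt hs.le, Real.sq_sqrt ht.le] at h1
  have h2 : ν.toFun (Matrix.fromBlocks ((((√s)⁻¹ : ℝ) : ℂ) • v) 0 0 ((((√t)⁻¹ : ℝ) : ℂ) • w)) ≤ 1 := by
    refine (ν.blocks_le _ _).trans (max_le ?_ ?_) <;>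
    · refine (ν.smul_le _ _).trans ?_
      rw [Complex.norm_real, Real.norm_of_nonneg (by positivity), inv_mul_le_iff₀ (by assumption)]
      simpa
  calc _ ≤ 1 * √(s + t) := mul_le_mul h2 h1 (norm_nonneg _) zero_le_one
    _ = _ := one_mul _

end MatrixSeminorm

/-- An operator space: a Banach space together with matrix norms that satisfy Ruan's axioms and
restrict to the given norm on `1 × 1` matrices. -/
class OperatorSpace (X : Type*) [NormedAddCommGroup X] [NormedSpace ℂ X] extends
    MatrixSeminorm X, CompleteSpace X where
  unit_eq : ∀ x : X, toFun (unit x) = ‖x‖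

/-- The norm of a matrix over an operator space. -/
abbrev mnorm {X : Type*} [NormedAddCommGroup X] [NormedSpace ℂ X] [OperatorSpace X]
    {m n : Type} [Fintype m] [Fintype n] (x : Matrix m n X) : ℝ :=
  (OperatorSpace.toMatrixSeminorm (X := X)).toFun x

/-! ## Completion -/

namespace MatrixSeminorm

open UniformSpace

variable {V : Type*} [SeminormedAddCommGroup V] [NormedSpace ℂ V] (ν : MatrixSeminorm V)
variable {m n k l : Type} [Fintype m] [Fintype n] [Fintype k] [Fintype l]

/-- The continuous extension of a matrix seminorm to matrices over the completion; see
`completionFun_coe` and `continuous_completionFun`. -/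
def completionFun (v : Matrix m n (Completion V)) : ℝ :=
  ⨅ w : Matrix m n V, ν.toFun w + ∑ i, ∑ j, ‖v i j - (w i j : Completion V)‖

theorem completionFun_bdd (v : Matrix m n (Completion V)) :
    BddBelow (Set.range fun w : Matrix m n V =>
      ν.toFun w + ∑ i, ∑ j, ‖v i j - (w i j : Completion V)‖) := by
  refine ⟨0, ?_⟩
  rintro _ ⟨w, rfl⟩
  have := ν.nonneg w
  positivity

theorem completionFun_lip (v v' : Matrix m n (Completion V)) :
    ν.completionFun v ≤ ν.completionFun v' + ∑ i, ∑ j, ‖v i j - v' i j‖ := by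
  rw [← sub_le_iff_le_add]
  refine le_ciInf fun w => ?_
  rw [sub_le_iff_le_add]
  refine (ciInf_le (ν.completionFun_bdd v) w).trans ?_
  rw [add_assoc]
  gcongr
  simp_rw [← Finset.sum_add_distrib]
  gcongr with i _ j _
  rw [add_comm]
  exact norm_sub_le_norm_sub_add_norm_sub _ _ _

theorem continuous_completionFun : Continuous (ν.completionFun (m := m) (n := n)) := by
  rw [continuous_iff_continuousAt]
  intro v
  have hc : Continuous fun v' : Matrix m n (Completion V) => ∑ i, ∑ j, ‖v' i j - v i j‖ := by
    refine continuous_finsetSum _ fun i _ => continuous_finsetSum _ fun j _ => ?_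
    exact ((continuous_id.matrix_elem i j).sub continuous_const).norm
  have h0 := hc.tendsto v
  simp only [sub_self, norm_zero, Finset.sum_const_zero] at h0
  refine tendsto_iff_dist_tendsto_zero.2 (squeeze_zero (fun _ => dist_nonneg) (fun v' => ?_) h0)
  rw [Real.dist_eq, abs_sub_le_iff]
  have h1 := ν.completionFun_lip v' v
  have h2 := ν.completionFun_lip v v'
  simp_rw [norm_sub_rev (v _ _)] at h2
  constructor <;> linarith

theorem completionFun_coe (hν : ∀ x, ν.toFun (unit x) = ‖x‖) (w : Matrix m n V) :
    ν.completionFun (w.map ((↑) : V → Completion V)) = ν.toFun w := by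
  apply le_antisymm
  · refine (ciInf_le (ν.completionFun_bdd _) w).trans (le_of_eq ?_)
    simp
  · refine le_ciInf fun w' => ?_
    have h1 := ν.sub_le w w'
    have h2 := ν.le_sum (w - w')
    simp_rw [hν] at h2
    simp_rw [Matrix.map_apply, ← Completion.coe_sub, Completion.norm_coe]
    simp only [Matrix.sub_apply] at h2
    linarith

theorem denseRange_map_coe (V : Type*) [SeminormedAddCommGroup V] [NormedSpace ℂ V]
    (m n : Type) :
    DenseRange fun w : Matrix m n V => w.map ((↑) : V → Completion V) := by
  have : DenseRange (Pi.map fun (_ : m) => Pi.map fun (_ : n) => ((↑) : V → Completion V)) :=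
    DenseRange.piMap fun _ => DenseRange.piMap fun _ => Completion.denseRange_coe
  exact this

theorem continuous_mmul_left {X Y Z : Type*} [AddCommGroup X] [Module ℂ X] [AddCommGroup Y]
    [Module ℂ Y] [TopologicalSpace Y] [AddCommGroup Z] [Module ℂ Z] [TopologicalSpace Z]
    [ContinuousAdd Z] (β : X →ₗ[ℂ] Y →ₗ[ℂ] Z) (h : ∀ x, Continuous (β x)) (x : Matrix m k X) :
    Continuous fun y : Matrix k n Y => mmul β x y := by
  refine continuous_matrix fun i j => ?_
  exact continuous_finsetSum _ fun s _ => (h _).comp (continuous_id.matrix_elem s j)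

theorem continuous_mmul_right {X Y Z : Type*} [AddCommGroup X] [Module ℂ X] [AddCommGroup Y]
    [Module ℂ Y] [TopologicalSpace X] [AddCommGroup Z] [Module ℂ Z] [TopologicalSpace Z]
    [ContinuousAdd Z] (β : X →ₗ[ℂ] Y →ₗ[ℂ] Z) (h : ∀ y, Continuous fun x => β x y)
    (y : Matrix k n Y) :
    Continuous fun x : Matrix m k X => mmul β x y := by
  refine continuous_matrix fun i j => ?_
  exact continuous_finsetSum _ fun s _ => (h (y s j)).comp (continuous_id.matrix_elem i s)

/-- The extension of a matrix seminorm to the completion. -/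
def completion (hν : ∀ x, ν.toFun (unit x) = ‖x‖) : MatrixSeminorm (Completion V) where
  toFun := ν.completionFun
  add_le v w := by
    induction v, w using (denseRange_map_coe V _ _).induction_on₂ with
    | hp =>
      exact isClosed_le (ν.continuous_completionFun.comp (continuous_fst.add continuous_snd))
        ((ν.continuous_completionFun.comp continuous_fst).add
          (ν.continuous_completionFun.comp continuous_snd))
    | h v w =>
      rw [ν.completionFun_coe hν, ν.completionFun_coe hν, ← Matrix.map_add _ Completion.coe_add,
        ν.completionFun_coe hν]
      exact ν.add_le v w
  smul_left_le α v := by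
    induction v using (denseRange_map_coe V _ _).induction_on with
    | hp =>
      exact isClosed_le (ν.continuous_completionFun.comp
        (continuous_mmul_left _ (fun c => continuous_const_smul c) _))
        (continuous_const.mul ν.continuous_completionFun)
    | ih v =>
      rw [ν.completionFun_coe hν]
      refine le_trans (le_of_eq ?_) (ν.smul_left_le α v)
      rw [← ν.completionFun_coe hν]
      congr 1
      ext i j
      simp only [mmul, Matrix.of_apply, Matrix.map_apply, LinearMap.lsmul_apply]
      rw [← Completion.coe_toComplL (𝕜 := ℂ)]
      simp
  smul_right_le v α := by
    induction v using (denseRange_map_coe V _ _).induction_on with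
    | hp =>
      exact isClosed_le (ν.continuous_completionFun.comp
        (continuous_mmul_right _ (fun c => continuous_const_smul c) _))
        (ν.continuous_completionFun.mul continuous_const)
    | ih v =>
      rw [ν.completionFun_coe hν]
      refine le_trans (le_of_eq ?_) (ν.smul_right_le v α)
      rw [← ν.completionFun_coe hν]
      congr 1
      ext i j
      simp only [mmul, Matrix.of_apply, Matrix.map_apply, LinearMap.lsmul_apply,
        LinearMap.flip_apply]
      rw [← Completion.coe_toComplL (𝕜 := ℂ)]
      simp
  blocks_le v w := by
    induction v using (denseRange_map_coe V _ _).induction_on with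
    | hp =>
      exact isClosed_le (ν.continuous_completionFun.comp
        (continuous_id.matrix_fromBlocks continuous_const continuous_const continuous_const))
        (ν.continuous_completionFun.max continuous_const)
    | ih v =>
      induction w using (denseRange_map_coe V _ _).induction_on with
      | hp =>
        exact isClosed_le (ν.continuous_completionFun.comp
          (continuous_const.matrix_fromBlocks continuous_const continuous_const continuous_id))
          (continuous_const.max ν.continuous_completionFun)
      | ih w =>
        rw [ν.completionFun_coe hν, ν.completionFun_coe hν]
        refine le_trans (le_of_eq ?_) (ν.blocks_le v w)
        rw [← ν.completionFun_coe hν, Matrix.fromBlocks_map]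
        congr 2

/-- The completion of a seminormed space with a compatible matrix seminorm is an operator space. -/
@[reducible] def completionOperatorSpace (hν : ∀ x, ν.toFun (unit x) = ‖x‖) :
    OperatorSpace (Completion V) where
  toMatrixSeminorm := ν.completion hν
  toCompleteSpace := inferInstance
  unit_eq x := by
    induction x using Completion.induction_on with
    | hp =>
      refine isClosed_eq (ν.continuous_completionFun.comp ?_) continuous_norm
      exact continuous_matrix fun _ _ => continuous_id
    | ih x =>
      rw [Completion.norm_coe, ← hν]
      exact ν.completionFun_coe hν (unit x)

end MatrixSeminorm

theorem continuous_mnorm {X : Type*} [NormedAddCommGroup X] [NormedSpace ℂ X] [OperatorSpace X]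
    {m n : Type} [Fintype m] [Fintype n] : Continuous (mnorm : Matrix m n X → ℝ) := by
  rw [continuous_iff_continuousAt]
  intro v
  have hc : Continuous fun v' : Matrix m n X => ∑ i, ∑ j, ‖v' i j - v i j‖ := by
    refine continuous_finsetSum _ fun i _ => continuous_finsetSum _ fun j _ => ?_
    exact ((continuous_id.matrix_elem i j).sub continuous_const).norm
  have h0 := hc.tendsto v
  simp only [sub_self, norm_zero, Finset.sum_const_zero] at h0
  refine tendsto_iff_dist_tendsto_zero.2 (squeeze_zero (fun _ => dist_nonneg) (fun v' => ?_) h0)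
  rw [Real.dist_eq, abs_sub_le_iff]
  have h1 := MatrixSeminorm.sub_le (OperatorSpace.toMatrixSeminorm (X := X)) v' v
  have h2 := MatrixSeminorm.sub_le (OperatorSpace.toMatrixSeminorm (X := X)) v v'
  have h3 := MatrixSeminorm.le_sum (OperatorSpace.toMatrixSeminorm (X := X)) (v' - v)
  have h4 := MatrixSeminorm.le_sum (OperatorSpace.toMatrixSeminorm (X := X)) (v - v')
  simp only [OperatorSpace.unit_eq, Matrix.sub_apply] at h3 h4
  simp_rw [norm_sub_rev (v _ _)] at h4
  constructor
  · exact h1.trans h3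
  · exact h2.trans h4

/-! ## The Haagerup tensor product -/

section Haagerup

variable {X Y : Type*} [NormedAddCommGroup X] [NormedSpace ℂ X] [OperatorSpace X]
  [NormedAddCommGroup Y] [NormedSpace ℂ Y] [OperatorSpace Y]

/-- The quotient of the algebraic tensor product `X ⊗ Y` by a space `N` of relations. -/
def PreTensor (N : Submodule ℂ (X ⊗[ℂ] Y)) := (X ⊗[ℂ] Y) ⧸ N

variable (N : Submodule ℂ (X ⊗[ℂ] Y))

instance : AddCommGroup (PreTensor N) := inferInstanceAs (AddCommGroup ((X ⊗[ℂ] Y) ⧸ N))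
instance : Module ℂ (PreTensor N) := inferInstanceAs (Module ℂ ((X ⊗[ℂ] Y) ⧸ N))

/-- The quotient map. -/
def PreTensor.proj : X ⊗[ℂ] Y →ₗ[ℂ] PreTensor N := N.mkQ

theorem PreTensor.proj_surjective : Function.Surjective (PreTensor.proj N) :=
  Submodule.mkQ_surjective N

/-- Linear maps out of the quotient. -/
def PreTensor.liftQ {Z : Type*} [AddCommGroup Z] [Module ℂ Z] (f : X ⊗[ℂ] Y →ₗ[ℂ] Z)
    (h : N ≤ LinearMap.ker f) : PreTensor N →ₗ[ℂ] Z := N.liftQ f h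

/-- The class of `x ⊗ y`. -/
def PreTensor.mk : X →ₗ[ℂ] Y →ₗ[ℂ] PreTensor N :=
  (TensorProduct.mk ℂ X Y).compr₂ (PreTensor.proj N)

variable {m n k l : Type} [Fintype m] [Fintype n] [Fintype k] [Fintype l]

/-- The Haagerup seminorm of a matrix `u` over `(X ⊗ Y) / N`: the infimum of `‖x‖ ‖y‖` over all
factorizations `u = x ⊙ y` into rectangular matrices `x` over `X` and `y` over `Y`, where
`(x ⊙ y) i j = ∑ s, x i s ⊗ y s j`. -/
def hnorm (u : Matrix m n (PreTensor N)) : ℝ :=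
  sInf {r : ℝ | ∃ (k : Type) (_ : Fintype k) (x : Matrix m k X) (y : Matrix k n Y),
    mmul (PreTensor.mk N) x y = u ∧ mnorm x * mnorm y = r}

theorem exists_factor (u : Matrix m n (PreTensor N)) :
    ∃ (k : Type) (_ : Fintype k) (x : Matrix m k X) (y : Matrix k n Y),
      mmul (PreTensor.mk N) x y = u := by
  classical
  induction u using Matrix.induction_on' with
  | h_zero => exact ⟨Unit, inferInstance, 0, 0, by ext; simp [mmul]⟩
  | h_add u v hu hv =>
    obtain ⟨k, _, x, y, rfl⟩ := hu
    obtain ⟨l, _, x', y', rfl⟩ := hv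
    exact ⟨k ⊕ l, inferInstance, _, _, mmul_fromCols_fromRows _ x x' y y'⟩
  | h_std_basis i j t =>
    obtain ⟨t, rfl⟩ := PreTensor.proj_surjective N t
    induction t using TensorProduct.induction_on with
    | zero => exact ⟨Unit, inferInstance, 0, 0, by ext; simp [mmul]⟩
    | tmul x y =>
      refine ⟨Unit, inferInstance, Matrix.single i () x, Matrix.single () j y, ?_⟩
      ext a b
      by_cases h1 : i = a <;> by_cases h2 : j = b <;> simp [mmul, Matrix.single, h1, h2]
      rfl
    | add t t' ht ht' =>
      obtain ⟨k, _, x, y, hx⟩ := ht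
      obtain ⟨l, _, x', y', hx'⟩ := ht'
      refine ⟨k ⊕ l, inferInstance, _, _, (mmul_fromCols_fromRows _ x x' y y').trans ?_⟩
      rw [hx, hx', map_add, Matrix.single_add]

theorem hnorm_bdd (u : Matrix m n (PreTensor N)) :
    BddBelow {r : ℝ | ∃ (k : Type) (_ : Fintype k) (x : Matrix m k X) (y : Matrix k n Y),
      mmul (PreTensor.mk N) x y = u ∧ mnorm x * mnorm y = r} := by
  refine ⟨0, ?_⟩
  rintro _ ⟨k, _, x, y, -, rfl⟩
  exact mul_nonneg (MatrixSeminorm.nonneg _ _) (MatrixSeminorm.nonneg _ _)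

theorem hnorm_mmul_le (x : Matrix m k X) (y : Matrix k n Y) :
    hnorm N (mmul (PreTensor.mk N) x y) ≤ mnorm x * mnorm y :=
  csInf_le (hnorm_bdd N _) ⟨k, _, x, y, rfl, rfl⟩

theorem exists_of_hnorm_lt {u : Matrix m n (PreTensor N)} {r : ℝ} (h : hnorm N u < r) :
    ∃ (k : Type) (_ : Fintype k) (x : Matrix m k X) (y : Matrix k n Y),
      mmul (PreTensor.mk N) x y = u ∧ mnorm x * mnorm y < r := by
  obtain ⟨k, i, x, y, h0⟩ := exists_factor N u
  obtain ⟨_, ⟨k, i, x, y, h1, rfl⟩, h2⟩ :=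
    (csInf_lt_iff (hnorm_bdd N u) ⟨_, k, i, x, y, h0, rfl⟩).1 h
  exact ⟨k, i, x, y, h1, h2⟩

theorem hnorm_nonneg (u : Matrix m n (PreTensor N)) : 0 ≤ hnorm N u := by
  refine Real.sInf_nonneg ?_
  rintro _ ⟨k, _, x, y, -, rfl⟩
  exact mul_nonneg (MatrixSeminorm.nonneg _ _) (MatrixSeminorm.nonneg _ _)

theorem mmul_smul_smul {Z : Type*} [AddCommGroup Z] [Module ℂ Z] (β : X →ₗ[ℂ] Y →ₗ[ℂ] Z)
    (a b : ℂ) (x : Matrix m k X) (y : Matrix k n Y) :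
    mmul β (a • x) (b • y) = (a * b) • mmul β x y := by
  ext i j
  simp [mmul, Finset.smul_sum, smul_smul, mul_comm]

/-- A factorization may be balanced. -/
theorem exists_balanced {u : Matrix m n (PreTensor N)} {r : ℝ} (h : hnorm N u < r) :
    ∃ (k : Type) (_ : Fintype k) (x : Matrix m k X) (y : Matrix k n Y),
      mmul (PreTensor.mk N) x y = u ∧ mnorm x ≤ √r ∧ mnorm y ≤ √r := by
  obtain ⟨k, i, x, y, h1, h2⟩ := exists_of_hnorm_lt N h
  have hx : 0 ≤ mnorm x := MatrixSeminorm.nonneg _ _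
  have hy : 0 ≤ mnorm y := MatrixSeminorm.nonneg _ _
  have hr : 0 < r := (mul_nonneg hx hy).trans_lt h2
  have hr' := Real.sqrt_pos.2 hr
  obtain ⟨s, hs, h3, h4⟩ : ∃ s : ℝ, 0 < s ∧ s * mnorm x ≤ √r ∧ s⁻¹ * mnorm y ≤ √r := by
    rcases hx.eq_or_lt with h0 | h0
    · refine ⟨mnorm y / √r + 1, by positivity, by rw [← h0]; simp, ?_⟩
      rw [inv_mul_le_iff₀ (by positivity), add_mul, div_mul_cancel₀ _ hr'.ne']
      linarith
    · refine ⟨√r / mnorm x, by positivity, by rw [div_mul_cancel₀ _ h0.ne'], ?_⟩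
      rw [inv_div, div_mul_eq_mul_div, div_le_iff₀ hr', Real.mul_self_sqrt hr.le]
      exact h2.le
  refine ⟨k, i, (s : ℂ) • x, ((s⁻¹ : ℝ) : ℂ) • y, ?_, ?_, ?_⟩
  · rw [mmul_smul_smul, ← Complex.ofReal_mul, mul_inv_cancel₀ hs.ne', Complex.ofReal_one, one_smul,
      h1]
  · refine (MatrixSeminorm.smul_le _ _ _).trans (le_of_eq_of_le ?_ h3)
    rw [Complex.norm_real, Real.norm_of_nonneg hs.le]
  · refine (MatrixSeminorm.smul_le _ _ _).trans (le_of_eq_of_le ?_ h4)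
    rw [Complex.norm_real, Real.norm_of_nonneg (by positivity)]

/-- The Haagerup seminorms satisfy Ruan's axioms. -/
def haagerupSeminorm : MatrixSeminorm (PreTensor N) where
  toFun := hnorm N
  add_le v w := by
    refine le_of_forall_pos_le_add fun ε hε => ?_
    obtain ⟨k, _, x, y, rfl, hx, hy⟩ := exists_balanced N (lt_add_of_pos_right (hnorm N v)
      (half_pos hε))
    obtain ⟨l, _, x', y', rfl, hx', hy'⟩ := exists_balanced N (lt_add_of_pos_right (hnorm N w)
      (half_pos hε))
    have p1 := add_pos_of_nonneg_of_pos (hnorm_nonneg N (mmul (PreTensor.mk N) x y)) (half_pos hε)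
    have p2 := add_pos_of_nonneg_of_pos (hnorm_nonneg N (mmul (PreTensor.mk N) x' y')) (half_pos hε)
    have q1 := MatrixSeminorm.fromCols_le _ p1 p2 hx hx'
    have q2 := MatrixSeminorm.fromRows_le _ p1 p2 hy hy'
    rw [← mmul_fromCols_fromRows]
    refine (hnorm_mmul_le N _ _).trans ((mul_le_mul q1 q2 (MatrixSeminorm.nonneg _ _)
      (Real.sqrt_nonneg _)).trans ?_)
    rw [Real.mul_self_sqrt (by linarith)]
    linarith
  smul_left_le α v := by
    refine le_of_forall_pos_le_add fun ε hε => ?_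
    obtain ⟨δ, hδ, hδ'⟩ : ∃ δ : ℝ, 0 < δ ∧ ‖α‖ * δ ≤ ε := by
      refine ⟨ε / (‖α‖ + 1), by positivity, ?_⟩
      rw [mul_div_assoc', div_le_iff₀ (by positivity)]
      nlinarith [norm_nonneg α]
    obtain ⟨k, _, x, y, rfl, hx⟩ := exists_of_hnorm_lt N (lt_add_of_pos_right (hnorm N v) hδ)
    rw [← mmul_assoc (β₁ := LinearMap.lsmul ℂ X) (β₂ := PreTensor.mk N) (by simp)]
    refine (hnorm_mmul_le N _ _).trans ?_
    have h1 := (OperatorSpace.toMatrixSeminorm (X := X)).smul_left_le α x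
    have h2 : 0 ≤ mnorm y := MatrixSeminorm.nonneg _ _
    nlinarith [mul_le_mul_of_nonneg_right h1 h2, mul_le_mul_of_nonneg_left hx.le (norm_nonneg α)]
  smul_right_le v α := by
    refine le_of_forall_pos_le_add fun ε hε => ?_
    obtain ⟨δ, hδ, hδ'⟩ : ∃ δ : ℝ, 0 < δ ∧ ‖α‖ * δ ≤ ε := by
      refine ⟨ε / (‖α‖ + 1), by positivity, ?_⟩
      rw [mul_div_assoc', div_le_iff₀ (by positivity)]
      nlinarith [norm_nonneg α]
    obtain ⟨k, _, x, y, rfl, hx⟩ := exists_of_hnorm_lt N (lt_add_of_pos_right (hnorm N v) hδ)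
    rw [mmul_assoc (β₃ := (LinearMap.lsmul ℂ Y).flip) (β₄ := PreTensor.mk N) (by simp)]
    refine (hnorm_mmul_le N _ _).trans ?_
    have h1 := (OperatorSpace.toMatrixSeminorm (X := Y)).smul_right_le y α
    have h2 : 0 ≤ mnorm x := MatrixSeminorm.nonneg _ _
    nlinarith [mul_le_mul_of_nonneg_left h1 h2, mul_le_mul_of_nonneg_left hx.le (norm_nonneg α)]
  blocks_le v w := by
    refine le_of_forall_pos_le_add fun ε hε => ?_
    set r := max (hnorm N v) (hnorm N w) + ε with hr
    have hv : hnorm N v < r := by have := le_max_left (hnorm N v) (hnorm N w); linarith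
    have hw : hnorm N w < r := by have := le_max_right (hnorm N v) (hnorm N w); linarith
    have hr0 := (hnorm_nonneg N v).trans_lt hv
    obtain ⟨k, _, x, y, rfl, hx, hy⟩ := exists_balanced N hv
    obtain ⟨l, _, x', y', rfl, hx', hy'⟩ := exists_balanced N hw
    rw [← mmul_blocks]
    have q1 := (OperatorSpace.toMatrixSeminorm.blocks_le x x').trans (max_le hx hx')
    have q2 := (OperatorSpace.toMatrixSeminorm.blocks_le y y').trans (max_le hy hy')
    refine (hnorm_mmul_le N _ _).trans ((mul_le_mul q1 q2 (MatrixSeminorm.nonneg _ _)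
      (Real.sqrt_nonneg _)).trans ?_)
    rw [Real.mul_self_sqrt hr0.le]

instance : SeminormedAddCommGroup (PreTensor N) :=
  AddGroupSeminorm.toSeminormedAddCommGroup
    { toFun := fun t => hnorm N (unit t)
      map_zero' := (haagerupSeminorm N).zero_eq
      add_le' := fun s t => (haagerupSeminorm N).add_le (unit s) (unit t)
      neg' := fun s => (haagerupSeminorm N).neg_eq (unit s) }

instance : NormedSpace ℂ (PreTensor N) where
  norm_smul_le c t := (haagerupSeminorm N).smul_le c (unit t)

/-- The Haagerup tensor product of `X` and `Y` modulo the closed subspace generated by `N`: the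
(separated) completion of `(X ⊗ Y) / N` in the Haagerup seminorm. For `N = ⊥` this is the Haagerup
tensor product `X ⊗̃ Y`, and in general it is the quotient of `X ⊗̃ Y` by the closure of `N`, with
the quotient matrix norms. -/
def HTensor : Type _ := UniformSpace.Completion (PreTensor N)

instance : NormedAddCommGroup (HTensor N) :=
  inferInstanceAs (NormedAddCommGroup (UniformSpace.Completion (PreTensor N)))
instance : NormedSpace ℂ (HTensor N) :=
  inferInstanceAs (NormedSpace ℂ (UniformSpace.Completion (PreTensor N)))
instance : OperatorSpace (HTensor N) :=
  (haagerupSeminorm N).completionOperatorSpace fun _ => rfl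

/-- The canonical map from the algebraic tensor product. -/
def HTensor.ofPre : PreTensor N →L[ℂ] HTensor N := UniformSpace.Completion.toComplL

/-- The elementary tensor `x ⊗ y` in the Haagerup tensor product. -/
def tmul : X →ₗ[ℂ] Y →ₗ[ℂ] HTensor N := (PreTensor.mk N).compr₂ (HTensor.ofPre N).toLinearMap

theorem mmul_tmul (x : Matrix m k X) (y : Matrix k n Y) :
    (mmul (PreTensor.mk N) x y).map (HTensor.ofPre N) = mmul (tmul N) x y :=
  mmul_map (map_zero _) (map_add _) (fun _ _ => rfl) x y

theorem mnorm_ofPre (u : Matrix m n (PreTensor N)) :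
    mnorm (u.map (HTensor.ofPre N)) = hnorm N u :=
  (haagerupSeminorm N).completionFun_coe (fun _ => rfl) u

theorem mnorm_mmul_tmul_le (x : Matrix m k X) (y : Matrix k n Y) :
    mnorm (mmul (tmul N) x y) ≤ mnorm x * mnorm y := by
  rw [← mmul_tmul, mnorm_ofPre]
  exact hnorm_mmul_le N x y

theorem denseRange_ofPre (m n : Type) :
    DenseRange fun w : Matrix m n (PreTensor N) => w.map (HTensor.ofPre N) :=
  MatrixSeminorm.denseRange_map_coe (PreTensor N) m n

variable {N}

theorem HTensor.induction {p : HTensor N → Prop} (t : HTensor N) (hp : IsClosed {t | p t})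
    (h0 : p 0) (htmul : ∀ x y, p (tmul N x y)) (hadd : ∀ s t, p s → p t → p (s + t)) : p t := by
  induction t using UniformSpace.Completion.induction_on with
  | hp => exact hp
  | ih t =>
    obtain ⟨t, rfl⟩ := PreTensor.proj_surjective N t
    change p (HTensor.ofPre N (PreTensor.proj N t))
    induction t using TensorProduct.induction_on with
    | zero =>
      rw [map_zero]
      exact (map_zero (HTensor.ofPre N)).symm ▸ h0
    | tmul x y => exact htmul x y
    | add s t hs ht =>
      rw [map_add]
      exact (map_add (HTensor.ofPre N) (PreTensor.proj N s) (PreTensor.proj N t)).symm ▸ hadd _ _ hs ht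

theorem HTensor.ext {Z : Type*} [NormedAddCommGroup Z] [NormedSpace ℂ Z]
    {f g : HTensor N →L[ℂ] Z} (h : ∀ x y, f (tmul N x y) = g (tmul N x y)) : f = g := by
  ext t
  induction t using HTensor.induction with
  | hp => exact isClosed_eq f.continuous g.continuous
  | h0 => simp
  | htmul x y => exact h x y
  | hadd s t hs ht => rw [map_add, map_add, hs, ht]

/-- To bound a continuous map on matrices over the tensor product it is enough to bound it on the
products `x ⊙ y`. -/
theorem HTensor.bound {Z : Type*} [NormedAddCommGroup Z] [NormedSpace ℂ Z] [OperatorSpace Z]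
    {m' n' : Type} [Fintype m'] [Fintype n']
    (F : Matrix m n (HTensor N) → Matrix m' n' Z) (hF : Continuous F) {C : ℝ}
    (h : ∀ (k : Type) [Fintype k] (x : Matrix m k X) (y : Matrix k n Y),
      mnorm (F (mmul (tmul N) x y)) ≤ C * (mnorm x * mnorm y)) (hC : 0 ≤ C)
    (u : Matrix m n (HTensor N)) : mnorm (F u) ≤ C * mnorm u := by
  induction u using (denseRange_ofPre N m n).induction_on with
  | hp => exact isClosed_le (continuous_mnorm.comp hF) (continuous_const.mul continuous_mnorm)
  | ih u =>
    rw [mnorm_ofPre]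
    refine le_of_forall_pos_le_add fun ε hε => ?_
    obtain ⟨δ, hδ, hδ'⟩ : ∃ δ : ℝ, 0 < δ ∧ C * δ ≤ ε := by
      refine ⟨ε / (C + 1), by positivity, ?_⟩
      rw [mul_div_assoc', div_le_iff₀ (by positivity)]
      nlinarith
    obtain ⟨k, _, x, y, rfl, hx⟩ := exists_of_hnorm_lt N (lt_add_of_pos_right (hnorm N u) hδ)
    rw [mmul_tmul]
    refine (h k x y).trans ?_
    nlinarith [mul_le_mul_of_nonneg_left hx.le hC]

/-- A bilinear map is row-column bounded if `‖∑ s, β (x s) (y s)‖ ≤ C ‖x‖ ‖y‖` for all rows `x` and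
all columns `y`. This is what it takes to extend to the Haagerup tensor product as a bounded map. -/
def RCBounded {Z : Type*} [NormedAddCommGroup Z] [NormedSpace ℂ Z]
    (β : X →ₗ[ℂ] Y →ₗ[ℂ] Z) : Prop :=
  ∃ C : ℝ, ∀ (k : Type) [Fintype k] (x : Matrix Unit k X) (y : Matrix k Unit Y),
    ‖mmul β x y () ()‖ ≤ C * (mnorm x * mnorm y)

variable (N) in
/-- The extension of a bilinear map that vanishes on the relations to the Haagerup tensor product:
the bounded linear map with `x ⊗ y ↦ β x y`. -/
def HTensor.lift {Z : Type*} [NormedAddCommGroup Z] [NormedSpace ℂ Z] [CompleteSpace Z]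
    (β : X →ₗ[ℂ] Y →ₗ[ℂ] Z) (hN : N ≤ LinearMap.ker (TensorProduct.lift β)) (hβ : RCBounded β) :
    HTensor N →L[ℂ] Z :=
  ContinuousLinearMap.extend
    (LinearMap.mkContinuousOfExistsBound (PreTensor.liftQ N (TensorProduct.lift β) hN)
      (by
        obtain ⟨C, hC⟩ := hβ
        refine ⟨max C 0, fun t => le_of_forall_pos_le_add fun ε hε => ?_⟩
        obtain ⟨δ, hδ, hδ'⟩ : ∃ δ : ℝ, 0 < δ ∧ max C 0 * δ ≤ ε := by
          refine ⟨ε / (max C 0 + 1), by positivity, ?_⟩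
          rw [mul_div_assoc', div_le_iff₀ (by positivity)]
          nlinarith [le_max_right C 0]
        obtain ⟨k, _, x, y, h1, hx⟩ := exists_of_hnorm_lt N
          (lt_add_of_pos_right (hnorm N (unit t)) hδ)
        have h2 : mmul β x y () () = (PreTensor.liftQ N (TensorProduct.lift β) hN) t := by
          have h3 := mmul_map (f := (PreTensor.liftQ N (TensorProduct.lift β) hN))
            (β := PreTensor.mk N) (β' := β) (map_zero _) (map_add _)
            (fun x y => by rfl) x y
          rw [← h3, h1]; rfl
        rw [← h2]
        refine (hC k x y).trans ?_
        have h4 : 0 ≤ mnorm x * mnorm y :=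
          mul_nonneg (MatrixSeminorm.nonneg _ _) (MatrixSeminorm.nonneg _ _)
        change _ ≤ max C 0 * hnorm N (unit t) + ε
        nlinarith [mul_le_mul_of_nonneg_left hx.le (le_max_right C 0),
          mul_le_mul_of_nonneg_right (le_max_left C 0) h4]))
    (HTensor.ofPre N)

@[simp] theorem HTensor.lift_tmul {Z : Type*} [NormedAddCommGroup Z] [NormedSpace ℂ Z]
    [CompleteSpace Z] (β : X →ₗ[ℂ] Y →ₗ[ℂ] Z)
    (hN : N ≤ LinearMap.ker (TensorProduct.lift β)) (hβ : RCBounded β) (x : X) (y : Y) :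
    HTensor.lift N β hN hβ (tmul N x y) = β x y :=
  ContinuousLinearMap.extend_eq _ UniformSpace.Completion.denseRange_coe
    (UniformSpace.Completion.isUniformInducing_coe _) (PreTensor.mk N x y)

end Haagerup

theorem mnorm_unit {X : Type*} [NormedAddCommGroup X] [NormedSpace ℂ X] [OperatorSpace X] (x : X) :
    mnorm (unit x) = ‖x‖ :=
  OperatorSpace.unit_eq x

theorem norm_entry_le {X : Type*} [NormedAddCommGroup X] [NormedSpace ℂ X] [OperatorSpace X]
    {m n : Type} [Fintype m] [Fintype n] (u : Matrix m n X) (i : m) (j : n) :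
    ‖u i j‖ ≤ mnorm u := by
  rw [← OperatorSpace.unit_eq]
  exact MatrixSeminorm.entry_le _ u i j

/-! ## Graded operator algebras and operator modules -/

/-- A grading of an operator space by `ℤ/2`, given by a completely isometric linear involution
`grade`, which is `x ↦ (-1) ^ ∂x • x` on homogeneous elements. The trivial grading is the
identity. -/
class Graded (X : Type*) [NormedAddCommGroup X] [NormedSpace ℂ X] [OperatorSpace X] where
  /-- The grading operator. -/
  grade : X →ₗ[ℂ] X
  grade_grade : ∀ x, grade (grade x) = x
  mnorm_grade : ∀ {m n : Type} [Fintype m] [Fintype n] (x : Matrix m n X),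
    mnorm (x.map grade) = mnorm x


/-- The (unital, graded) operator algebras: the multiplication is completely contractive. -/
class OperatorAlgebra (A : Type*) [NormedRing A] [NormedAlgebra ℂ A] [OperatorSpace A]
    [Graded A] : Prop where
  mnorm_mul_le : ∀ {m k n : Type} [Fintype m] [Fintype k] [Fintype n]
    (a : Matrix m k A) (b : Matrix k n A),
    mnorm (mmul (LinearMap.mul ℂ A) a b) ≤ mnorm a * mnorm b
  grade_mul : ∀ a b : A, Graded.grade (a * b) = Graded.grade a * Graded.grade b

section Actions

variable (A X : Type*) [NormedRing A] [NormedAlgebra ℂ A] [NormedAddCommGroup X] [NormedSpace ℂ X]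

/-- A left action as a bilinear map `(a, x) ↦ a x`. -/
def lact [Module A X] [IsScalarTower ℂ A X] : A →ₗ[ℂ] X →ₗ[ℂ] X :=
  LinearMap.mk₂ ℂ (fun a x => a • x) (fun a b x => add_smul a b x) (fun c a x => smul_assoc c a x)
    (fun a x y => smul_add a x y) (fun c a x => smul_comm a c x)

/-- A right action as a bilinear map `(x, a) ↦ x a`. -/
def ract [Module Aᵐᵒᵖ X] [IsScalarTower ℂ Aᵐᵒᵖ X] : X →ₗ[ℂ] A →ₗ[ℂ] X :=
  LinearMap.mk₂ ℂ (fun x a => MulOpposite.op a • x) (fun x y a => smul_add _ x y)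
    (fun c x a => smul_comm _ c x) (fun x a b => by rw [MulOpposite.op_add, add_smul])
    (fun c x a => by rw [MulOpposite.op_smul, smul_assoc])

@[simp] theorem lact_apply [Module A X] [IsScalarTower ℂ A X] (a : A) (x : X) :
    lact A X a x = a • x := rfl

@[simp] theorem ract_apply [Module Aᵐᵒᵖ X] [IsScalarTower ℂ Aᵐᵒᵖ X] (a : A) (x : X) :
    ract A X x a = MulOpposite.op a • x := rfl

variable [OperatorSpace A] [Graded A] [OperatorSpace X] [Graded X]

/-- A graded left operator module: the action `A × X → X` is completely contractive. -/
class LeftOperatorModule [Module A X] [IsScalarTower ℂ A X] : Prop where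
  mnorm_smul_le : ∀ {m k n : Type} [Fintype m] [Fintype k] [Fintype n]
    (a : Matrix m k A) (x : Matrix k n X), mnorm (mmul (lact A X) a x) ≤ mnorm a * mnorm x
  grade_smul : ∀ (a : A) (x : X), Graded.grade (a • x) = Graded.grade a • Graded.grade x

/-- A graded right operator module: the action `X × A → X` is completely contractive. Right
modules are modules over the opposite ring: `x a` is `MulOpposite.op a • x`. -/
class RightOperatorModule [Module Aᵐᵒᵖ X] [IsScalarTower ℂ Aᵐᵒᵖ X] : Prop where
  mnorm_smul_le : ∀ {m k n : Type} [Fintype m] [Fintype k] [Fintype n]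
    (x : Matrix m k X) (a : Matrix k n A), mnorm (mmul (ract A X) x a) ≤ mnorm x * mnorm a
  grade_smul : ∀ (a : A) (x : X),
    Graded.grade (MulOpposite.op a • x) = MulOpposite.op (Graded.grade a) • Graded.grade x

end Actions

/-! ## Maps between tensor products; actions and gradings on them -/

section Functoriality

variable {X Y X' Y' : Type*} [NormedAddCommGroup X] [NormedSpace ℂ X] [OperatorSpace X]
  [NormedAddCommGroup Y] [NormedSpace ℂ Y] [OperatorSpace Y]
  [NormedAddCommGroup X'] [NormedSpace ℂ X'] [OperatorSpace X']
  [NormedAddCommGroup Y'] [NormedSpace ℂ Y'] [OperatorSpace Y']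

/-- The canonical map from the algebraic to the Haagerup tensor product. -/
def ofTensor (N : Submodule ℂ (X ⊗[ℂ] Y)) : X ⊗[ℂ] Y →ₗ[ℂ] HTensor N :=
  (HTensor.ofPre N).toLinearMap ∘ₗ PreTensor.proj N

theorem le_ker_ofTensor (N : Submodule ℂ (X ⊗[ℂ] Y)) : N ≤ LinearMap.ker (ofTensor N) := by
  intro t ht
  have : PreTensor.proj N t = 0 := (Submodule.Quotient.mk_eq_zero N).2 ht
  simp [ofTensor, this]

/-- The map `f ⊗ g`, when it is row-column bounded. -/
def HTensor.map (N : Submodule ℂ (X ⊗[ℂ] Y)) (N' : Submodule ℂ (X' ⊗[ℂ] Y'))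
    (f : X →ₗ[ℂ] X') (g : Y →ₗ[ℂ] Y') (h : N ≤ N'.comap (TensorProduct.map f g))
    (hb : RCBounded ((tmul N').compl₁₂ f g)) : HTensor N →L[ℂ] HTensor N' :=
  HTensor.lift N ((tmul N').compl₁₂ f g) (by
    have e : TensorProduct.lift ((tmul N').compl₁₂ f g) =
        ofTensor N' ∘ₗ TensorProduct.map f g := by
      ext x y; rfl
    rw [e]
    exact fun t ht => le_ker_ofTensor N' (h ht)) hb

@[simp] theorem HTensor.map_tmul (N : Submodule ℂ (X ⊗[ℂ] Y)) (N' : Submodule ℂ (X' ⊗[ℂ] Y'))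
    (f : X →ₗ[ℂ] X') (g : Y →ₗ[ℂ] Y') (h : N ≤ N'.comap (TensorProduct.map f g))
    (hb : RCBounded ((tmul N').compl₁₂ f g)) (x : X) (y : Y) :
    HTensor.map N N' f g h hb (tmul N x y) = tmul N' (f x) (g y) :=
  HTensor.lift_tmul _ _ _ _ _

theorem mmul_compl₁₂ {Z : Type*} [AddCommGroup Z] [Module ℂ Z] (β : X' →ₗ[ℂ] Y' →ₗ[ℂ] Z)
    (f : X →ₗ[ℂ] X') (g : Y →ₗ[ℂ] Y') {m n k : Type} [Fintype k]
    (x : Matrix m k X) (y : Matrix k n Y) :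
    mmul (β.compl₁₂ f g) x y = mmul β (x.map f) (y.map g) := rfl

theorem rcBounded_of_le {N' : Submodule ℂ (X' ⊗[ℂ] Y')} {f : X →ₗ[ℂ] X'} {g : Y →ₗ[ℂ] Y'}
    {C D : ℝ} (hf : ∀ (k : Type) [Fintype k] (x : Matrix Unit k X), mnorm (x.map f) ≤ C * mnorm x)
    (hg : ∀ (k : Type) [Fintype k] (y : Matrix k Unit Y), mnorm (y.map g) ≤ D * mnorm y)
    (hC : 0 ≤ C) :
    RCBounded ((tmul N').compl₁₂ f g) := by
  refine ⟨C * D, fun k _ x y => (norm_entry_le _ _ _).trans ?_⟩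
  rw [mmul_compl₁₂]
  refine (mnorm_mmul_tmul_le N' _ _).trans ((mul_le_mul (hf k x) (hg k y)
    (MatrixSeminorm.nonneg _ _) (mul_nonneg hC (MatrixSeminorm.nonneg _ _))).trans (le_of_eq ?_))
  ring

theorem mnorm_map_id_le {k m : Type} [Fintype k] [Fintype m] (x : Matrix m k X) :
    mnorm (x.map (LinearMap.id : X →ₗ[ℂ] X)) ≤ 1 * mnorm x := by
  rw [one_mul]; exact le_of_eq (by congr 1)

end Functoriality

section Stable

variable {X Y : Type*} [NormedAddCommGroup X] [NormedSpace ℂ X] [OperatorSpace X]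
  [NormedAddCommGroup Y] [NormedSpace ℂ Y] [OperatorSpace Y]

/-- The relations are stable under a left action on the first factor. -/
class LeftStable (A : Type*) [NormedRing A] [NormedAlgebra ℂ A] [Module A X] [IsScalarTower ℂ A X]
    (N : Submodule ℂ (X ⊗[ℂ] Y)) : Prop where
  le : ∀ a : A, N ≤ N.comap (TensorProduct.map (lact A X a) LinearMap.id)

/-- The relations are stable under a right action on the second factor. -/
class RightStable (B : Type*) [NormedRing B] [NormedAlgebra ℂ B] [Module Bᵐᵒᵖ Y]
    [IsScalarTower ℂ Bᵐᵒᵖ Y] (N : Submodule ℂ (X ⊗[ℂ] Y)) : Prop where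
  le : ∀ b : B, N ≤ N.comap (TensorProduct.map LinearMap.id ((ract B Y).flip b))

/-- The relations are stable under the grading. -/
class GradeStable [Graded X] [Graded Y] (N : Submodule ℂ (X ⊗[ℂ] Y)) : Prop where
  le : N ≤ N.comap (TensorProduct.map (Graded.grade (X := X)) (Graded.grade (X := Y)))

variable (N : Submodule ℂ (X ⊗[ℂ] Y))

section Left

variable {A : Type*} [NormedRing A] [NormedAlgebra ℂ A] [OperatorSpace A] [Graded A] [Graded X]
  [Module A X] [IsScalarTower ℂ A X] [LeftOperatorModule A X]

theorem mnorm_lact_le {k : Type} [Fintype k] (a : A) (x : Matrix Unit k X) :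
    mnorm (x.map (lact A X a)) ≤ ‖a‖ * mnorm x := by
  rw [← OperatorSpace.unit_eq]
  refine le_of_eq_of_le ?_ (LeftOperatorModule.mnorm_smul_le (unit a) x)
  congr 1
  ext i j
  simp [mmul]

variable [LeftStable A N]

/-- Left multiplication by `a` on the tensor product: `x ⊗ y ↦ a x ⊗ y`. -/
def HTensor.lmulL (a : A) : HTensor N →L[ℂ] HTensor N :=
  HTensor.map N N (lact A X a) LinearMap.id (LeftStable.le a)
    (rcBounded_of_le (fun _ _ x => mnorm_lact_le a x) (fun _ _ y => mnorm_map_id_le y)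
      (norm_nonneg a))

instance : Module A (HTensor N) where
  smul a t := HTensor.lmulL N a t
  one_smul t := DFunLike.congr_fun (HTensor.ext (f := HTensor.lmulL N (1 : A))
    (g := ContinuousLinearMap.id ℂ _) fun x y => by simp [HTensor.lmulL]) t
  mul_smul a b t := DFunLike.congr_fun (HTensor.ext (f := HTensor.lmulL N (a * b))
    (g := HTensor.lmulL N a ∘L HTensor.lmulL N b)
    fun x y => by simp [HTensor.lmulL, mul_smul]) t
  smul_zero a := map_zero (HTensor.lmulL N a)
  smul_add a := map_add (HTensor.lmulL N a)
  add_smul a b t := DFunLike.congr_fun (HTensor.ext (f := HTensor.lmulL N (a + b))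
    (g := HTensor.lmulL N a + HTensor.lmulL N b)
    fun x y => by simp [HTensor.lmulL, add_smul]) t
  zero_smul t := DFunLike.congr_fun (HTensor.ext (f := HTensor.lmulL N (0 : A))
    (g := 0) fun x y => by simp [HTensor.lmulL]) t

@[simp] theorem smul_tmul (a : A) (x : X) (y : Y) : a • tmul N x y = tmul N (a • x) y :=
  HTensor.map_tmul _ _ _ _ _ _ _ _

theorem continuous_smul_left (a : A) : Continuous fun t : HTensor N => a • t :=
  (HTensor.lmulL N a).continuous

instance : IsScalarTower ℂ A (HTensor N) where
  smul_assoc c a t := DFunLike.congr_fun (HTensor.ext (f := HTensor.lmulL N (c • a))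
    (g := c • HTensor.lmulL N a) fun x y => by simp [HTensor.lmulL]) t

end Left

section Right

variable {B : Type*} [NormedRing B] [NormedAlgebra ℂ B] [OperatorSpace B] [Graded B] [Graded Y]
  [Module Bᵐᵒᵖ Y] [IsScalarTower ℂ Bᵐᵒᵖ Y] [RightOperatorModule B Y]

theorem mnorm_ract_le {k : Type} [Fintype k] (b : B) (y : Matrix k Unit Y) :
    mnorm (y.map ((ract B Y).flip b)) ≤ ‖b‖ * mnorm y := by
  rw [← OperatorSpace.unit_eq, mul_comm]
  refine le_of_eq_of_le ?_ (RightOperatorModule.mnorm_smul_le y (unit b))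
  congr 1
  ext i j
  simp [mmul]

variable [RightStable B N]

/-- Right multiplication by `b` on the tensor product: `x ⊗ y ↦ x ⊗ y b`. -/
def HTensor.rmulL (b : B) : HTensor N →L[ℂ] HTensor N :=
  HTensor.map N N LinearMap.id ((ract B Y).flip b) (RightStable.le b)
    (rcBounded_of_le (fun _ _ x => mnorm_map_id_le x) (fun _ _ y => mnorm_ract_le b y)
      zero_le_one)

instance : Module Bᵐᵒᵖ (HTensor N) where
  smul b t := HTensor.rmulL N b.unop t
  one_smul t := DFunLike.congr_fun (HTensor.ext (f := HTensor.rmulL N (1 : B))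
    (g := ContinuousLinearMap.id ℂ _) fun x y => by simp [HTensor.rmulL]) t
  mul_smul a b t := DFunLike.congr_fun (HTensor.ext (f := HTensor.rmulL N (b.unop * a.unop))
    (g := HTensor.rmulL N a.unop ∘L HTensor.rmulL N b.unop)
    fun x y => by simp [HTensor.rmulL, mul_smul]) t
  smul_zero a := map_zero (HTensor.rmulL N a.unop)
  smul_add a := map_add (HTensor.rmulL N a.unop)
  add_smul a b t := DFunLike.congr_fun (HTensor.ext (f := HTensor.rmulL N (a.unop + b.unop))
    (g := HTensor.rmulL N a.unop + HTensor.rmulL N b.unop)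
    fun x y => by simp [HTensor.rmulL, add_smul]) t
  zero_smul t := DFunLike.congr_fun (HTensor.ext (f := HTensor.rmulL N (0 : B))
    (g := 0) fun x y => by simp [HTensor.rmulL]) t

@[simp] theorem op_smul_tmul (b : B) (x : X) (y : Y) :
    MulOpposite.op b • tmul N x y = tmul N x (MulOpposite.op b • y) :=
  HTensor.map_tmul _ _ _ _ _ _ _ _

theorem continuous_smul_right (b : B) : Continuous fun t : HTensor N => MulOpposite.op b • t :=
  (HTensor.rmulL N b).continuous

instance : IsScalarTower ℂ Bᵐᵒᵖ (HTensor N) where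
  smul_assoc c b t := DFunLike.congr_fun (HTensor.ext (f := HTensor.rmulL N (c • b.unop))
    (g := c • HTensor.rmulL N b.unop) fun x y => by simp [HTensor.rmulL]) t

end Right

section Bimodule

variable {A B : Type*} [NormedRing A] [NormedAlgebra ℂ A] [OperatorSpace A] [Graded A] [Graded X]
  [Module A X] [IsScalarTower ℂ A X] [LeftOperatorModule A X]
  [NormedRing B] [NormedAlgebra ℂ B] [OperatorSpace B] [Graded B] [Graded Y]
  [Module Bᵐᵒᵖ Y] [IsScalarTower ℂ Bᵐᵒᵖ Y] [RightOperatorModule B Y]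
  [LeftStable A N] [RightStable B N]

instance : SMulCommClass A Bᵐᵒᵖ (HTensor N) where
  smul_comm a b t := DFunLike.congr_fun (HTensor.ext
    (f := HTensor.lmulL N a ∘L HTensor.rmulL N b.unop)
    (g := HTensor.rmulL N b.unop ∘L HTensor.lmulL N a)
    fun x y => by simp [HTensor.rmulL, HTensor.lmulL]) t

end Bimodule

section Grading

variable [Graded X] [Graded Y] [GradeStable N]

/-- The grading `γ ⊗ γ` of the tensor product. -/
def HTensor.gradeL : HTensor N →L[ℂ] HTensor N :=
  HTensor.map N N Graded.grade Graded.grade GradeStable.le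
    (rcBounded_of_le (C := 1) (D := 1) (fun _ _ x => by rw [Graded.mnorm_grade, one_mul])
      (fun _ _ y => by rw [Graded.mnorm_grade, one_mul]) zero_le_one)

theorem HTensor.gradeL_tmul (x : X) (y : Y) :
    HTensor.gradeL N (tmul N x y) = tmul N (Graded.grade x) (Graded.grade y) :=
  HTensor.map_tmul _ _ _ _ _ _ _ _

theorem HTensor.gradeL_gradeL (t : HTensor N) :
    HTensor.gradeL N (HTensor.gradeL N t) = t :=
  DFunLike.congr_fun (HTensor.ext (f := HTensor.gradeL N ∘L HTensor.gradeL N)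
    (g := ContinuousLinearMap.id ℂ _)
    fun x y => by simp [HTensor.gradeL_tmul, Graded.grade_grade]) t

theorem continuous_map_clm {m n : Type} {Z Z' : Type*} [NormedAddCommGroup Z] [NormedSpace ℂ Z]
    [NormedAddCommGroup Z'] [NormedSpace ℂ Z'] (f : Z →L[ℂ] Z') :
    Continuous fun u : Matrix m n Z => u.map f :=
  continuous_id.matrix_map f.continuous

theorem HTensor.mnorm_gradeL_le {m n : Type} [Fintype m] [Fintype n] (u : Matrix m n (HTensor N)) :
    mnorm (u.map (HTensor.gradeL N)) ≤ mnorm u := by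
  rw [← one_mul (mnorm u)]
  refine HTensor.bound _ (continuous_map_clm _) (fun k _ x y => ?_) zero_le_one u
  rw [mmul_map (β' := (tmul N).compl₁₂ Graded.grade Graded.grade) (map_zero _) (map_add _)
    (HTensor.gradeL_tmul N), mmul_compl₁₂, one_mul]
  refine (mnorm_mmul_tmul_le N _ _).trans (le_of_eq ?_)
  rw [Graded.mnorm_grade, Graded.mnorm_grade]

instance : Graded (HTensor N) where
  grade := (HTensor.gradeL N).toLinearMap
  grade_grade := HTensor.gradeL_gradeL N
  mnorm_grade u := by
    refine le_antisymm (HTensor.mnorm_gradeL_le N u) ?_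
    refine le_of_eq_of_le ?_ (HTensor.mnorm_gradeL_le N (u.map (HTensor.gradeL N)))
    congr 1
    ext i j
    exact (HTensor.gradeL_gradeL N _).symm

@[simp] theorem grade_tmul (x : X) (y : Y) :
    Graded.grade (tmul N x y) = tmul N (Graded.grade x) (Graded.grade y) :=
  HTensor.gradeL_tmul N x y

theorem continuous_grade {Z : Type*} [NormedAddCommGroup Z] [NormedSpace ℂ Z] [OperatorSpace Z]
    [Graded Z] : Continuous (Graded.grade : Z →ₗ[ℂ] Z) :=
  AddMonoidHomClass.continuous_of_bound _ 1 fun z => by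
    rw [← OperatorSpace.unit_eq, ← OperatorSpace.unit_eq, one_mul]
    exact (Graded.mnorm_grade (unit z)).le

instance {A : Type*} [NormedRing A] [NormedAlgebra ℂ A] [OperatorSpace A] [Graded A]
    [Module A X] [IsScalarTower ℂ A X] [LeftOperatorModule A X] [LeftStable A N] :
    LeftOperatorModule A (HTensor N) where
  mnorm_smul_le a u := by
    refine HTensor.bound _ (MatrixSeminorm.continuous_mmul_left _ (continuous_smul_left N) a)
      (fun k _ x y => ?_) (MatrixSeminorm.nonneg _ _) u
    rw [← mmul_assoc (β₁ := lact A X) (β₂ := tmul N) (by simp), ← mul_assoc]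
    exact (mnorm_mmul_tmul_le N _ _).trans (mul_le_mul_of_nonneg_right
      (LeftOperatorModule.mnorm_smul_le a x) (MatrixSeminorm.nonneg _ _))
  grade_smul a t := DFunLike.congr_fun (HTensor.ext
    (f := HTensor.gradeL N ∘L HTensor.lmulL N a)
    (g := HTensor.lmulL N (Graded.grade a) ∘L HTensor.gradeL N)
    fun x y => by simp [HTensor.gradeL, HTensor.lmulL, LeftOperatorModule.grade_smul]) t

instance {B : Type*} [NormedRing B] [NormedAlgebra ℂ B] [OperatorSpace B] [Graded B]
    [Module Bᵐᵒᵖ Y] [IsScalarTower ℂ Bᵐᵒᵖ Y] [RightOperatorModule B Y] [RightStable B N] :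
    RightOperatorModule B (HTensor N) where
  mnorm_smul_le u b := by
    rw [mul_comm]
    refine HTensor.bound (fun u => mmul (ract B (HTensor N)) u b)
      (MatrixSeminorm.continuous_mmul_right _ (continuous_smul_right N) b)
      (fun k _ x y => ?_) (MatrixSeminorm.nonneg _ _) u
    rw [mmul_assoc (β₃ := ract B Y) (β₄ := tmul N) (by simp), mul_comm, mul_assoc]
    exact (mnorm_mmul_tmul_le N _ _).trans (mul_le_mul_of_nonneg_left
      (RightOperatorModule.mnorm_smul_le y b) (MatrixSeminorm.nonneg _ _))
  grade_smul b t := DFunLike.congr_fun (HTensor.ext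
    (f := HTensor.gradeL N ∘L HTensor.rmulL N b)
    (g := HTensor.rmulL N (Graded.grade b) ∘L HTensor.gradeL N)
    fun x y => by simp [HTensor.gradeL, HTensor.rmulL, RightOperatorModule.grade_smul]) t

end Grading

end Stable

/-! ## The module Haagerup tensor product -/

section ModTensor

variable (A : Type*) [NormedRing A] [NormedAlgebra ℂ A]
variable (X Y : Type*) [NormedAddCommGroup X] [NormedSpace ℂ X] [OperatorSpace X]
  [NormedAddCommGroup Y] [NormedSpace ℂ Y] [OperatorSpace Y]
  [Module Aᵐᵒᵖ X] [Module A Y]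

/-- The linear span of the elements `x a ⊗ y - x ⊗ a y`. -/
def rel : Submodule ℂ (X ⊗[ℂ] Y) :=
  Submodule.span ℂ {t | ∃ (x : X) (a : A) (y : Y),
    t = (MulOpposite.op a • x) ⊗ₜ[ℂ] y - x ⊗ₜ[ℂ] (a • y)}

/-- The module Haagerup tensor product `X ⊗̃_A Y`. -/
abbrev ModTensor := HTensor (rel A X Y)

/-- The Haagerup tensor product `X ⊗̃ Y`. -/
abbrev PlainTensor := HTensor (⊥ : Submodule ℂ (X ⊗[ℂ] Y))

variable {A X Y}

theorem rel_le {S : Submodule ℂ (X ⊗[ℂ] Y)}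
    (h : ∀ (x : X) (a : A) (y : Y), (MulOpposite.op a • x) ⊗ₜ[ℂ] y - x ⊗ₜ[ℂ] (a • y) ∈ S) :
    rel A X Y ≤ S := by
  refine Submodule.span_le.2 ?_
  rintro _ ⟨x, a, y, rfl⟩
  exact h x a y

theorem rel_le_ker {Z : Type*} [AddCommGroup Z] [Module ℂ Z] {β : X →ₗ[ℂ] Y →ₗ[ℂ] Z}
    (h : ∀ (x : X) (a : A) (y : Y), β (MulOpposite.op a • x) y = β x (a • y)) :
    rel A X Y ≤ LinearMap.ker (TensorProduct.lift β) :=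
  rel_le fun x a y => by simp [h]

theorem rel_le_comap {X' Y' : Type*} [NormedAddCommGroup X'] [NormedSpace ℂ X'] [OperatorSpace X']
    [NormedAddCommGroup Y'] [NormedSpace ℂ Y'] [OperatorSpace Y'] [Module Aᵐᵒᵖ X'] [Module A Y']
    {f : X →ₗ[ℂ] X'} {g : Y →ₗ[ℂ] Y'} (σ : A → A)
    (hf : ∀ (x : X) (a : A), f (MulOpposite.op a • x) = MulOpposite.op (σ a) • f x)
    (hg : ∀ (a : A) (y : Y), g (a • y) = σ a • g y) :
    rel A X Y ≤ (rel A X' Y').comap (TensorProduct.map f g) :=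
  rel_le fun x a y => by
    rw [Submodule.mem_comap, map_sub, TensorProduct.map_tmul, TensorProduct.map_tmul, hf, hg]
    exact Submodule.subset_span ⟨_, _, _, rfl⟩

/-- `x a ⊗ y = x ⊗ a y`. -/
theorem tmul_balanced (x : X) (a : A) (y : Y) :
    tmul (rel A X Y) (MulOpposite.op a • x) y = tmul (rel A X Y) x (a • y) := by
  have h := le_ker_ofTensor (rel A X Y) (Submodule.subset_span ⟨x, a, y, rfl⟩)
  rw [LinearMap.mem_ker, map_sub] at h
  exact sub_eq_zero.1 h

instance {B : Type*} [NormedRing B] [NormedAlgebra ℂ B] [Module B X] [IsScalarTower ℂ B X]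
    [SMulCommClass B Aᵐᵒᵖ X] : LeftStable B (rel A X Y) where
  le b := rel_le_comap id (fun x a => by simp [smul_comm]) (fun a y => rfl)

instance {B : Type*} [NormedRing B] [NormedAlgebra ℂ B] [Module Bᵐᵒᵖ Y] [IsScalarTower ℂ Bᵐᵒᵖ Y]
    [SMulCommClass A Bᵐᵒᵖ Y] : RightStable B (rel A X Y) where
  le b := rel_le_comap id (fun x a => rfl) (fun a y => by simp [smul_comm])

instance [OperatorSpace A] [Graded A] [Graded X] [Graded Y] [IsScalarTower ℂ Aᵐᵒᵖ X]
    [IsScalarTower ℂ A Y] [RightOperatorModule A X] [LeftOperatorModule A Y] :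
    GradeStable (rel A X Y) where
  le := rel_le_comap Graded.grade (fun x a => RightOperatorModule.grade_smul a x)
    (fun a y => LeftOperatorModule.grade_smul a y)

instance {B : Type*} [NormedRing B] [NormedAlgebra ℂ B] [Module B X] [IsScalarTower ℂ B X] :
    LeftStable B (⊥ : Submodule ℂ (X ⊗[ℂ] Y)) where
  le _ := bot_le

instance {B : Type*} [NormedRing B] [NormedAlgebra ℂ B] [Module Bᵐᵒᵖ Y] [IsScalarTower ℂ Bᵐᵒᵖ Y] :
    RightStable B (⊥ : Submodule ℂ (X ⊗[ℂ] Y)) where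
  le _ := bot_le

instance [Graded X] [Graded Y] : GradeStable (⊥ : Submodule ℂ (X ⊗[ℂ] Y)) where
  le := bot_le

end ModTensor

/-! ## Universal forms -/

section Forms

variable (A : Type*) [NormedRing A] [NormedAlgebra ℂ A] [OperatorSpace A] [Graded A]
  [OperatorAlgebra A]

instance : LeftOperatorModule A A where
  mnorm_smul_le a x := OperatorAlgebra.mnorm_mul_le a x
  grade_smul a x := OperatorAlgebra.grade_mul a x

instance : RightOperatorModule A A where
  mnorm_smul_le x a := OperatorAlgebra.mnorm_mul_le x a
  grade_smul a x := OperatorAlgebra.grade_mul x a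

theorem grade_one : Graded.grade (1 : A) = 1 := by
  have h := OperatorAlgebra.grade_mul (1 : A) (Graded.grade 1)
  rw [one_mul, Graded.grade_grade, mul_one] at h
  exact h.symm

/-- The graded multiplication `A ⊗̃ A → A`, `a ⊗ b ↦ (-1) ^ ∂b a b`. -/
def gradedMul : PlainTensor A A →L[ℂ] A :=
  HTensor.lift ⊥ ((LinearMap.mul ℂ A).compl₂ Graded.grade) bot_le
    ⟨1, fun k _ x y => (norm_entry_le _ _ _).trans (by
      refine (OperatorAlgebra.mnorm_mul_le x (y.map Graded.grade)).trans (le_of_eq ?_)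
      rw [Graded.mnorm_grade, one_mul])⟩

@[simp] theorem gradedMul_tmul (a b : A) :
    gradedMul A (tmul ⊥ a b) = a * Graded.grade b :=
  HTensor.lift_tmul _ _ _ _ _

variable {A}

theorem gradedMul_smul (a : A) (t : PlainTensor A A) :
    gradedMul A (a • t) = a * gradedMul A t :=
  DFunLike.congr_fun (HTensor.ext (f := gradedMul A ∘L HTensor.lmulL ⊥ a)
    (g := ContinuousLinearMap.mul ℂ A a ∘L gradedMul A)
    fun x y => by simp [HTensor.lmulL, mul_assoc]) t

theorem gradedMul_op_smul (a : A) (t : PlainTensor A A) :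
    gradedMul A (MulOpposite.op a • t) = gradedMul A t * Graded.grade a :=
  DFunLike.congr_fun (HTensor.ext (f := gradedMul A ∘L HTensor.rmulL ⊥ a)
    (g := (ContinuousLinearMap.mul ℂ A).flip (Graded.grade a) ∘L gradedMul A)
    fun x y => by simp [HTensor.rmulL, mul_assoc, OperatorAlgebra.grade_mul]) t

theorem gradedMul_grade (t : PlainTensor A A) :
    gradedMul A (Graded.grade t) = Graded.grade (gradedMul A t) :=
  DFunLike.congr_fun (HTensor.ext (f := gradedMul A ∘L HTensor.gradeL ⊥)
    (g := (⟨Graded.grade, continuous_grade⟩ : A →L[ℂ] A) ∘L gradedMul A)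
    fun x y => by simp [HTensor.gradeL_tmul, OperatorAlgebra.grade_mul]) t

variable (A)

/-- The bimodule `Ω¹(A)` of universal `1`-forms: the kernel of the graded multiplication
`A ⊗̃ A → A`. -/
def Omega : Type _ := LinearMap.ker (gradedMul A).toLinearMap

namespace Omega

instance : NormedAddCommGroup (Omega A) :=
  inferInstanceAs (NormedAddCommGroup (LinearMap.ker (gradedMul A).toLinearMap))
instance : NormedSpace ℂ (Omega A) :=
  inferInstanceAs (NormedSpace ℂ (LinearMap.ker (gradedMul A).toLinearMap))

/-- The inclusion `Ω¹(A) → A ⊗̃ A`. -/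
def incl : Omega A →L[ℂ] PlainTensor A A := (LinearMap.ker (gradedMul A).toLinearMap).subtypeL

variable {A}

theorem incl_injective : Function.Injective (incl A) := Subtype.val_injective

@[simp] theorem gradedMul_incl (ω : Omega A) : gradedMul A (incl A ω) = 0 := ω.2

/-- An element of `A ⊗̃ A` in the kernel of the graded multiplication, as a form. -/
def mk (t : PlainTensor A A) (h : gradedMul A t = 0) : Omega A := ⟨t, h⟩

@[simp] theorem incl_mk (t : PlainTensor A A) (h : gradedMul A t = 0) : incl A (mk t h) = t := rfl

instance : OperatorSpace (Omega A) where
  toFun v := mnorm (v.map (incl A))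
  add_le v w := by
    rw [Matrix.map_add _ (map_add (incl A))]
    exact MatrixSeminorm.add_le _ _ _
  smul_left_le α v := by
    rw [mmul_map (β' := (LinearMap.lsmul ℂ _).compl₂ (incl A).toLinearMap) (map_zero _) (map_add _)
      (fun c x => map_smul (incl A) c x)]
    exact MatrixSeminorm.smul_left_le _ α (v.map (incl A))
  smul_right_le v α := by
    rw [mmul_map (β' := ((LinearMap.lsmul ℂ _).compl₂ (incl A).toLinearMap).flip) (map_zero _)
      (map_add _) (fun x c => map_smul (incl A) c x)]
    exact MatrixSeminorm.smul_right_le _ (v.map (incl A)) α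
  blocks_le v w := by
    rw [Matrix.fromBlocks_map, Matrix.map_zero _ (map_zero _), Matrix.map_zero _ (map_zero _)]
    exact MatrixSeminorm.blocks_le _ _ _
  toCompleteSpace := (ContinuousLinearMap.isClosed_ker (gradedMul A)).completeSpace_coe
  unit_eq ω := OperatorSpace.unit_eq (incl A ω)

theorem mnorm_incl {m n : Type} [Fintype m] [Fintype n] (v : Matrix m n (Omega A)) :
    mnorm (v.map (incl A)) = mnorm v := rfl

instance : Module A (Omega A) where
  smul a ω := mk (a • incl A ω) (by simp [gradedMul_smul])
  one_smul _ := incl_injective (one_smul A _)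
  mul_smul a b ω := incl_injective (mul_smul a b (incl A ω))
  smul_zero a := incl_injective (smul_zero a)
  smul_add a ω η := incl_injective (smul_add a (incl A ω) (incl A η))
  add_smul a b ω := incl_injective (add_smul a b (incl A ω))
  zero_smul _ := incl_injective (zero_smul A _)

instance : Module Aᵐᵒᵖ (Omega A) where
  smul a ω := mk (a • incl A ω) (by
    have := gradedMul_op_smul a.unop (incl A ω)
    simpa using this)
  one_smul _ := incl_injective (one_smul Aᵐᵒᵖ _)
  mul_smul a b ω := incl_injective (mul_smul a b (incl A ω))
  smul_zero a := incl_injective (smul_zero a)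
  smul_add a ω η := incl_injective (smul_add a (incl A ω) (incl A η))
  add_smul a b ω := incl_injective (add_smul a b (incl A ω))
  zero_smul _ := incl_injective (zero_smul Aᵐᵒᵖ _)

@[simp] theorem incl_smul (a : A) (ω : Omega A) : incl A (a • ω) = a • incl A ω := rfl
@[simp] theorem incl_op_smul (a : Aᵐᵒᵖ) (ω : Omega A) : incl A (a • ω) = a • incl A ω := rfl

instance : IsScalarTower ℂ A (Omega A) where
  smul_assoc c a ω := incl_injective (smul_assoc c a (incl A ω))
instance : IsScalarTower ℂ Aᵐᵒᵖ (Omega A) where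
  smul_assoc c a ω := incl_injective (smul_assoc c a (incl A ω))
instance : SMulCommClass A Aᵐᵒᵖ (Omega A) where
  smul_comm a b ω := incl_injective (smul_comm a b (incl A ω))

instance : Graded (Omega A) where
  grade := LinearMap.codRestrict (LinearMap.ker (gradedMul A).toLinearMap)
    (Graded.grade ∘ₗ (incl A).toLinearMap) fun ω => by
      change gradedMul A (Graded.grade (incl A ω)) = 0
      rw [gradedMul_grade, gradedMul_incl, map_zero]
  grade_grade ω := incl_injective (Graded.grade_grade (incl A ω))
  mnorm_grade v := Graded.mnorm_grade (v.map (incl A))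

@[simp] theorem incl_grade (ω : Omega A) :
    incl A (Graded.grade ω) = Graded.grade (incl A ω) := rfl

instance : LeftOperatorModule A (Omega A) where
  mnorm_smul_le a v := by
    rw [← mnorm_incl, mmul_map (β' := (lact A _).compl₂ (incl A).toLinearMap) (map_zero _)
      (map_add _) (fun c x => incl_smul c x)]
    exact LeftOperatorModule.mnorm_smul_le a (v.map (incl A))
  grade_smul a ω := incl_injective (LeftOperatorModule.grade_smul a (incl A ω))

instance : RightOperatorModule A (Omega A) where
  mnorm_smul_le v a := by
    rw [← mnorm_incl, mmul_map (β' := (ract A _) ∘ₗ (incl A).toLinearMap) (map_zero _)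
      (map_add _) (fun c x => rfl)]
    exact RightOperatorModule.mnorm_smul_le (v.map (incl A)) a
  grade_smul a ω := incl_injective (RightOperatorModule.grade_smul a (incl A ω))

/-- The universal derivation `d a = 1 ⊗ a - (-1) ^ ∂a a ⊗ 1`. -/
def d (a : A) : Omega A :=
  mk (tmul ⊥ 1 a - tmul ⊥ (Graded.grade a) 1) (by simp [grade_one])

end Omega

end Forms

/-! ## Associativity of the module Haagerup tensor product -/

/-- Completely bounded linear maps. -/
def CompletelyBounded {X Y : Type*} [NormedAddCommGroup X] [NormedSpace ℂ X] [OperatorSpace X]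
    [NormedAddCommGroup Y] [NormedSpace ℂ Y] [OperatorSpace Y] (f : X →ₗ[ℂ] Y) : Prop :=
  ∃ C : ℝ, ∀ {m n : Type} [Fintype m] [Fintype n] (x : Matrix m n X),
    mnorm (x.map f) ≤ C * mnorm x

theorem CompletelyBounded.exists_nonneg {X Y : Type*} [NormedAddCommGroup X] [NormedSpace ℂ X]
    [OperatorSpace X] [NormedAddCommGroup Y] [NormedSpace ℂ Y] [OperatorSpace Y] {f : X →ₗ[ℂ] Y}
    (h : CompletelyBounded f) : ∃ C : ℝ, 0 ≤ C ∧ ∀ {m n : Type} [Fintype m] [Fintype n]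
      (x : Matrix m n X), mnorm (x.map f) ≤ C * mnorm x := by
  obtain ⟨C, hC⟩ := h
  exact ⟨max C 0, le_max_right _ _, fun x => (hC x).trans
    (mul_le_mul_of_nonneg_right (le_max_left _ _) (MatrixSeminorm.nonneg _ _))⟩

section Assoc

variable (A B : Type*) [NormedRing A] [NormedAlgebra ℂ A] [OperatorSpace A] [Graded A]
  [NormedRing B] [NormedAlgebra ℂ B] [OperatorSpace B] [Graded B]
variable (X Y Z : Type*)
  [NormedAddCommGroup X] [NormedSpace ℂ X] [OperatorSpace X] [Graded X]
  [Module Aᵐᵒᵖ X] [IsScalarTower ℂ Aᵐᵒᵖ X] [RightOperatorModule A X]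
  [NormedAddCommGroup Y] [NormedSpace ℂ Y] [OperatorSpace Y] [Graded Y]
  [Module A Y] [IsScalarTower ℂ A Y] [LeftOperatorModule A Y]
  [Module Bᵐᵒᵖ Y] [IsScalarTower ℂ Bᵐᵒᵖ Y] [RightOperatorModule B Y] [SMulCommClass A Bᵐᵒᵖ Y]
  [NormedAddCommGroup Z] [NormedSpace ℂ Z] [OperatorSpace Z] [Graded Z]
  [Module B Z] [IsScalarTower ℂ B Z] [LeftOperatorModule B Z]

variable {X} in
/-- The map `y ⊗ z ↦ (x ⊗ y) ⊗ z` for fixed `x`. -/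
def assocAux (x : X) : ModTensor B Y Z →L[ℂ] ModTensor B (ModTensor A X Y) Z :=
  HTensor.map (rel B Y Z) (rel B (ModTensor A X Y) Z) (tmul (rel A X Y) x) LinearMap.id
    (rel_le_comap id (fun y b => (op_smul_tmul _ b x y).symm) (fun _ _ => rfl))
    (rcBounded_of_le (C := ‖x‖) (fun k _ y => by
      rw [← mnorm_unit]
      refine le_of_eq_of_le ?_ (mnorm_mmul_tmul_le (rel A X Y) (unit x) y)
      congr 1
      ext i j
      simp [mmul]) (fun _ _ z => mnorm_map_id_le z) (norm_nonneg x))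

variable {X Y Z} in
@[simp] theorem assocAux_tmul (x : X) (y : Y) (z : Z) :
    assocAux A B Y Z x (tmul _ y z) = tmul _ (tmul _ x y) z :=
  HTensor.map_tmul _ _ _ _ _ _ _ _

/-- The bilinear map `(x, y ⊗ z) ↦ (x ⊗ y) ⊗ z`. -/
def assocBilin : X →ₗ[ℂ] ModTensor B Y Z →ₗ[ℂ] ModTensor B (ModTensor A X Y) Z :=
  LinearMap.mk₂ ℂ (fun x t => assocAux A B Y Z x t)
    (fun x x' t => DFunLike.congr_fun (HTensor.ext (f := assocAux A B Y Z (x + x'))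
      (g := assocAux A B Y Z x + assocAux A B Y Z x') fun y z => by simp) t)
    (fun c x t => DFunLike.congr_fun (HTensor.ext (f := assocAux A B Y Z (c • x))
      (g := c • assocAux A B Y Z x) fun y z => by simp) t)
    (fun x => map_add (assocAux A B Y Z x)) (fun c x => map_smul (assocAux A B Y Z x) c)

variable {X Y Z} in
@[simp] theorem assocBilin_tmul (x : X) (y : Y) (z : Z) :
    assocBilin A B X Y Z x (tmul _ y z) = tmul _ (tmul _ x y) z :=
  assocAux_tmul A B x y z

theorem mnorm_assocBilin_le {m k n : Type} [Fintype m] [Fintype k] [Fintype n] (x : Matrix m k X)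
    (t : Matrix k n (ModTensor B Y Z)) :
    mnorm (mmul (assocBilin A B X Y Z) x t) ≤ mnorm x * mnorm t := by
  refine HTensor.bound _ (MatrixSeminorm.continuous_mmul_left _
    (fun x => (assocAux A B Y Z x).continuous) x) (fun l _ y z => ?_) (MatrixSeminorm.nonneg _ _) t
  rw [← mmul_assoc (β₁ := tmul (rel A X Y)) (β₂ := tmul (rel B (ModTensor A X Y) Z))
    (fun x y z => (assocBilin_tmul A B x y z).symm), ← mul_assoc]
  exact (mnorm_mmul_tmul_le _ _ _).trans (mul_le_mul_of_nonneg_right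
    (mnorm_mmul_tmul_le _ x y) (MatrixSeminorm.nonneg _ _))

/-- The natural map `X ⊗̃_A (Y ⊗̃_B Z) → (X ⊗̃_A Y) ⊗̃_B Z`, `x ⊗ (y ⊗ z) ↦ (x ⊗ y) ⊗ z`. -/
def assoc : ModTensor A X (ModTensor B Y Z) →L[ℂ] ModTensor B (ModTensor A X Y) Z :=
  HTensor.lift (rel A X (ModTensor B Y Z)) (assocBilin A B X Y Z)
    (rel_le_ker fun x a t => DFunLike.congr_fun
      (HTensor.ext (f := assocAux A B Y Z (MulOpposite.op a • x))
        (g := assocAux A B Y Z x ∘L HTensor.lmulL _ a)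
        fun y z => by simp [HTensor.lmulL, tmul_balanced]) t)
    ⟨1, fun k _ x t => (norm_entry_le _ _ _).trans (by
      rw [one_mul]
      exact mnorm_assocBilin_le A B X Y Z x t)⟩

variable {X Y Z}

@[simp] theorem assoc_tmul (x : X) (t : ModTensor B Y Z) :
    assoc A B X Y Z (tmul _ x t) = assocBilin A B X Y Z x t :=
  HTensor.lift_tmul _ _ _ _ _

theorem mnorm_assoc_le {m n : Type} [Fintype m] [Fintype n]
    (u : Matrix m n (ModTensor A X (ModTensor B Y Z))) :
    mnorm (u.map (assoc A B X Y Z)) ≤ mnorm u := by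
  rw [← one_mul (mnorm u)]
  refine HTensor.bound _ (continuous_map_clm _) (fun k _ x t => ?_) zero_le_one u
  rw [mmul_map (β' := assocBilin A B X Y Z) (map_zero _) (map_add _) (assoc_tmul A B), one_mul]
  exact mnorm_assocBilin_le A B X Y Z x t

theorem assoc_op_smul {C : Type*} [NormedRing C] [NormedAlgebra ℂ C] [OperatorSpace C] [Graded C]
    [Module Cᵐᵒᵖ Z] [IsScalarTower ℂ Cᵐᵒᵖ Z] [RightOperatorModule C Z] [SMulCommClass B Cᵐᵒᵖ Z]
    (c : C) (t : ModTensor A X (ModTensor B Y Z)) :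
    assoc A B X Y Z (MulOpposite.op c • t) = MulOpposite.op c • assoc A B X Y Z t := by
  refine DFunLike.congr_fun (HTensor.ext (f := assoc A B X Y Z ∘L HTensor.rmulL _ c)
    (g := HTensor.rmulL _ c ∘L assoc A B X Y Z) fun x s => ?_) t
  change assoc A B X Y Z (MulOpposite.op c • tmul _ x s) =
    MulOpposite.op c • assoc A B X Y Z (tmul _ x s)
  rw [op_smul_tmul, assoc_tmul, assoc_tmul]
  refine DFunLike.congr_fun (HTensor.ext
    (f := assocAux A B Y Z x ∘L HTensor.rmulL (rel B Y Z) c)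
    (g := HTensor.rmulL (rel B (ModTensor A X Y) Z) c ∘L assocAux A B Y Z x) fun y z => ?_) s
  simp [HTensor.rmulL]

end Assoc

/-! ## Connections -/

section Connections

/-- A universal connection on a right operator `A`-module `P`: a completely bounded linear map
`∇ : P → P ⊗̃_A Ω¹(A)` with `∇ (p a) = ∇ (p) a + (-1) ^ ∂p p ⊗ d a`. -/
structure Connection (A : Type*) [NormedRing A] [NormedAlgebra ℂ A] [OperatorSpace A] [Graded A]
    [OperatorAlgebra A] (P : Type*) [NormedAddCommGroup P] [NormedSpace ℂ P] [OperatorSpace P]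
    [Graded P] [Module Aᵐᵒᵖ P] [IsScalarTower ℂ Aᵐᵒᵖ P] [RightOperatorModule A P] where
  /-- The underlying map. -/
  toFun : P →ₗ[ℂ] ModTensor A P (Omega A)
  completelyBounded : CompletelyBounded toFun
  leibniz : ∀ (p : P) (a : A), toFun (MulOpposite.op a • p) =
    MulOpposite.op a • toFun p + tmul _ (Graded.grade p) (Omega.d a)

variable {A B : Type*} [NormedRing A] [NormedAlgebra ℂ A] [OperatorSpace A] [Graded A]
  [OperatorAlgebra A]
  [NormedRing B] [NormedAlgebra ℂ B] [OperatorSpace B] [Graded B] [OperatorAlgebra B]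
variable {P P' : Type*}
  [NormedAddCommGroup P] [NormedSpace ℂ P] [OperatorSpace P] [Graded P]
  [Module Aᵐᵒᵖ P] [IsScalarTower ℂ Aᵐᵒᵖ P] [RightOperatorModule A P]
  [NormedAddCommGroup P'] [NormedSpace ℂ P'] [OperatorSpace P'] [Graded P']
  [Module A P'] [IsScalarTower ℂ A P'] [LeftOperatorModule A P']
  [Module Bᵐᵒᵖ P'] [IsScalarTower ℂ Bᵐᵒᵖ P'] [RightOperatorModule B P'] [SMulCommClass A Bᵐᵒᵖ P']

namespace Connection

/-! For a connection `∇'` on the bimodule `P'`, let `δ a = [∇', a] = ∇' a - (-1) ^ ∂a a ∇'`. The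
bimodule map `j_δ` on `Ω¹(A)` with `j_δ (d a) = δ a` is the restriction of `a ⊗ b ↦ a ∇' b`. -/

/-- The map `a ⊗ b ↦ a ∇' (b p')` on `A ⊗̃ A`, for fixed `p'`. -/
def jAux (D : Connection B P') (p' : P') : PlainTensor A A →L[ℂ] ModTensor B P' (Omega B) :=
  HTensor.lift ⊥ ((lact A _).compl₂ (D.toFun ∘ₗ (lact A P').flip p')) bot_le (by
    obtain ⟨C, hC, h⟩ := D.completelyBounded.exists_nonneg
    refine ⟨C * ‖p'‖, fun k _ a b => (norm_entry_le _ _ _).trans ?_⟩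
    have e : mmul ((lact A (ModTensor B P' (Omega B))).compl₂ (D.toFun ∘ₗ (lact A P').flip p')) a b
        = mmul (lact A _) a ((mmul (lact A P') b (unit p')).map D.toFun) := by
      ext i j
      simp [mmul]
    rw [e]
    refine (LeftOperatorModule.mnorm_smul_le _ _).trans ?_
    have h1 := h (mmul (lact A P') b (unit p'))
    have h2 := LeftOperatorModule.mnorm_smul_le b (unit p')
    rw [mnorm_unit] at h2
    calc _ ≤ mnorm a * (C * (mnorm b * ‖p'‖)) :=
          mul_le_mul_of_nonneg_left (h1.trans (mul_le_mul_of_nonneg_left h2 hC))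
            (MatrixSeminorm.nonneg _ _)
      _ = _ := by ring)

@[simp] theorem jAux_tmul (D : Connection B P') (p' : P') (a b : A) :
    D.jAux p' (tmul ⊥ a b) = a • D.toFun (b • p') :=
  HTensor.lift_tmul _ _ _ _ _

theorem jAux_smul_left (D : Connection B P') (p' : P') (a : A) (t : PlainTensor A A) :
    D.jAux p' (a • t) = a • D.jAux p' t :=
  DFunLike.congr_fun (HTensor.ext (f := D.jAux p' ∘L HTensor.lmulL ⊥ a)
    (g := HTensor.lmulL _ a ∘L D.jAux p')
    fun x y => by
      simp only [HTensor.lmulL, ContinuousLinearMap.comp_apply, HTensor.map_tmul, jAux_tmul]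
      exact mul_smul a x _) t

theorem jAux_smul_right (D : Connection B P') (p' : P') (a : A) (t : PlainTensor A A) :
    D.jAux p' (MulOpposite.op a • t) = D.jAux (a • p') t :=
  DFunLike.congr_fun (HTensor.ext (f := D.jAux p' ∘L HTensor.rmulL ⊥ a)
    (g := D.jAux (a • p'))
    fun x y => by simp [HTensor.rmulL, mul_smul]) t

theorem jAux_op_smul (D : Connection B P') (p' : P') (b : B) (t : PlainTensor A A) :
    D.jAux (MulOpposite.op b • p') t = MulOpposite.op b • D.jAux p' t +
      gradedMul A t • tmul (rel B P' (Omega B)) (Graded.grade p') (Omega.d b) := by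
  refine DFunLike.congr_fun (HTensor.ext (f := D.jAux (MulOpposite.op b • p'))
    (g := HTensor.rmulL _ b ∘L D.jAux p' +
      (⟨(lact A _).flip (tmul (rel B P' (Omega B)) (Graded.grade p') (Omega.d b)), ?_⟩ :
        A →L[ℂ] ModTensor B P' (Omega B)) ∘L gradedMul A) fun x y => ?_) t
  · change Continuous fun a : A =>
      a • tmul (rel B P' (Omega B)) (Graded.grade p') (Omega.d b)
    simp only [smul_tmul]
    refine AddMonoidHomClass.continuous_of_bound
      (((tmul (rel B P' (Omega B))).flip (Omega.d b)) ∘ₗ (lact A P').flip (Graded.grade p'))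
      (‖Graded.grade p'‖ * ‖Omega.d b‖) fun a => ?_
    simp only [LinearMap.comp_apply, LinearMap.flip_apply, lact_apply]
    have h1 := mnorm_mmul_tmul_le (rel B P' (Omega B)) (unit (a • Graded.grade p'))
      (unit (Omega.d b))
    have h2 := LeftOperatorModule.mnorm_smul_le (unit a) (unit (Graded.grade p'))
    have e1 : mmul (tmul (rel B P' (Omega B))) (unit (a • Graded.grade p')) (unit (Omega.d b)) =
      unit (tmul (rel B P' (Omega B)) (a • Graded.grade p') (Omega.d b)) := by
      ext; simp [mmul]
    have e2 : mmul (lact A P') (unit a) (unit (Graded.grade p')) = unit (a • Graded.grade p') := by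
      ext; simp [mmul]
    rw [e1, mnorm_unit, mnorm_unit, mnorm_unit] at h1
    rw [e2, mnorm_unit, mnorm_unit, mnorm_unit] at h2
    refine h1.trans ((mul_le_mul_of_nonneg_right h2 (norm_nonneg _)).trans (le_of_eq ?_))
    ring
  · have h1 : (y • MulOpposite.op b • p' : P') = MulOpposite.op b • y • p' := smul_comm _ _ _
    change D.jAux (MulOpposite.op b • p') (tmul ⊥ x y) =
      MulOpposite.op b • D.jAux p' (tmul ⊥ x y) +
      gradedMul A (tmul ⊥ x y) • tmul (rel B P' (Omega B)) (Graded.grade p') (Omega.d b)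
    rw [jAux_tmul, jAux_tmul, h1, D.leibniz, smul_add, smul_comm x (MulOpposite.op b),
      gradedMul_tmul, LeftOperatorModule.grade_smul, ← smul_tmul, mul_smul]

/-- The bilinear map `(t, p') ↦ jAux p' t`. -/
def jBilin (D : Connection B P') : PlainTensor A A →ₗ[ℂ] P' →ₗ[ℂ] ModTensor B P' (Omega B) :=
  LinearMap.mk₂ ℂ (fun t p' => D.jAux p' t) (fun s t p' => map_add (D.jAux p') s t)
    (fun c t p' => map_smul (D.jAux p') c t)
    (fun t p q => DFunLike.congr_fun (HTensor.ext (f := D.jAux (p + q))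
      (g := D.jAux p + D.jAux q) fun x y => by simp) t)
    (fun c t p => DFunLike.congr_fun (HTensor.ext (f := D.jAux (c • p))
      (g := c • D.jAux p) fun x y => by
        have h : y • c • p = c • y • p := smul_comm _ _ _
        have h' : ∀ s : ModTensor B P' (Omega B), x • c • s = c • x • s := fun s => smul_comm _ _ _
        simp [h, h']) t)

theorem mnorm_jBilin_le (D : Connection B P') : ∃ C : ℝ, 0 ≤ C ∧
    ∀ {m k n : Type} [Fintype m] [Fintype k] [Fintype n] (t : Matrix m k (PlainTensor A A))
      (p' : Matrix k n P'), mnorm (mmul D.jBilin t p') ≤ C * (mnorm t * mnorm p') := by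
  obtain ⟨C, hC, h⟩ := D.completelyBounded.exists_nonneg
  refine ⟨C, hC, fun {m k n} _ _ _ t p' => ?_⟩
  have h0 : 0 ≤ mnorm p' := MatrixSeminorm.nonneg _ _
  rw [mul_comm (mnorm t), ← mul_assoc]
  refine HTensor.bound (fun t => mmul D.jBilin t p') (MatrixSeminorm.continuous_mmul_right _
    (fun p => (D.jAux p).continuous) p') (fun l _ a b => ?_) (mul_nonneg hC h0) t
  have e : mmul D.jBilin (mmul (tmul ⊥) a b) p' =
      mmul (lact A (ModTensor B P' (Omega B))) a ((mmul (lact A P') b p').map D.toFun) := by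
    rw [mmul_assoc (β₃ := (lact A P').compr₂ D.toFun)
      (β₄ := lact A (ModTensor B P' (Omega B))) (fun a b p => D.jAux_tmul p a b)]
    congr 1
    exact (mmul_map (map_zero _) (map_add _) (fun _ _ => rfl) _ _).symm
  rw [e]
  refine (LeftOperatorModule.mnorm_smul_le _ _).trans ?_
  have h1 := h (mmul (lact A P') b p')
  have h2 := LeftOperatorModule.mnorm_smul_le b p'
  calc _ ≤ mnorm a * (C * (mnorm b * mnorm p')) :=
        mul_le_mul_of_nonneg_left (h1.trans (mul_le_mul_of_nonneg_left h2 hC))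
          (MatrixSeminorm.nonneg _ _)
    _ = _ := by ring

/-- `j_δ : Ω¹(A) → Hom_B(P', P' ⊗̃_B Ω¹(B))` for `δ = [∇', ·]`, as the bilinear map
`(ω, p') ↦ j_δ (ω) p'`. It is characterized by `jMap_d` and `jMap_smul`. -/
def jMap (D : Connection B P') : Omega A →ₗ[ℂ] P' →ₗ[ℂ] ModTensor B P' (Omega B) :=
  D.jBilin ∘ₗ (Omega.incl A).toLinearMap

/-- `j_δ (d a) = [∇', a]`. -/
theorem jMap_d (D : Connection B P') (a : A) (p' : P') :
    D.jMap (Omega.d a) p' = D.toFun (a • p') - Graded.grade a • D.toFun p' := by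
  have h : D.jMap (Omega.d a) p' =
      D.jAux p' (tmul ⊥ 1 a - tmul ⊥ (Graded.grade a) 1) := rfl
  rw [h, map_sub, jAux_tmul, jAux_tmul, one_smul, one_smul]

/-- `j_δ` is a map of left modules. -/
theorem jMap_smul (D : Connection B P') (a : A) (ω : Omega A) (p' : P') :
    D.jMap (a • ω) p' = a • D.jMap ω p' :=
  D.jAux_smul_left p' a (Omega.incl A ω)

/-- `j_δ` is a map of right modules. -/
theorem jMap_smul_right (D : Connection B P') (a : A) (ω : Omega A) (p' : P') :
    D.jMap (MulOpposite.op a • ω) p' = D.jMap ω (a • p') :=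
  D.jAux_smul_right p' a (Omega.incl A ω)

/-- The values of `j_δ` are right `B`-module maps. -/
theorem jMap_op_smul (D : Connection B P') (ω : Omega A) (b : B) (p' : P') :
    D.jMap ω (MulOpposite.op b • p') = MulOpposite.op b • D.jMap ω p' := by
  have h := D.jAux_op_smul p' b (Omega.incl A ω)
  rw [Omega.gradedMul_incl, zero_smul, add_zero] at h
  exact h

theorem mnorm_jMap_le (D : Connection B P') : ∃ C : ℝ, 0 ≤ C ∧
    ∀ {m k n : Type} [Fintype m] [Fintype k] [Fintype n] (ω : Matrix m k (Omega A))
      (p' : Matrix k n P'), mnorm (mmul D.jMap ω p') ≤ C * (mnorm ω * mnorm p') := by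
  obtain ⟨C, hC, h⟩ := D.mnorm_jBilin_le (A := A)
  exact ⟨C, hC, fun ω p' => h (ω.map (Omega.incl A)) p'⟩

variable (A P) in
/-- The map `p ⊗ ω ↦ p ⊗ j_δ (ω) p'`, for fixed `p'`. -/
def evalAux (D : Connection B P') (p' : P') :
    ModTensor A P (Omega A) →L[ℂ] ModTensor A P (ModTensor B P' (Omega B)) :=
  HTensor.map _ _ LinearMap.id (D.jMap.flip p')
    (rel_le_comap id (fun _ _ => rfl) (fun a ω => D.jMap_smul a ω p'))
    (by
      obtain ⟨C, hC, h⟩ := D.mnorm_jMap_le (A := A)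
      refine rcBounded_of_le (C := 1) (D := C * ‖p'‖) (fun _ _ x => mnorm_map_id_le x)
        (fun k _ ω => ?_) zero_le_one
      rw [← mnorm_unit, mul_assoc, mul_comm (mnorm (unit p'))]
      refine le_of_eq_of_le ?_ (h ω (unit p'))
      congr 1
      ext i j
      simp [mmul])

@[simp] theorem evalAux_tmul (D : Connection B P') (p' : P') (p : P) (ω : Omega A) :
    D.evalAux A P p' (tmul _ p ω) = tmul _ p (D.jMap ω p') :=
  HTensor.map_tmul _ _ _ _ _ _ _ _

variable (A P) in
/-- The evaluation `(p ⊗ ω, p') ↦ p ⊗ j_δ (ω) p'`. For a connection `∇` on `P`, the value at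
`(∇ p, p')` is `∇_δ (p) p'`. -/
def eval (D : Connection B P') :
    ModTensor A P (Omega A) →ₗ[ℂ] P' →ₗ[ℂ] ModTensor A P (ModTensor B P' (Omega B)) :=
  LinearMap.mk₂ ℂ (fun t p' => D.evalAux A P p' t) (fun s t p' => map_add (D.evalAux A P p') s t)
    (fun c t p' => map_smul (D.evalAux A P p') c t)
    (fun t p q => DFunLike.congr_fun (HTensor.ext (f := D.evalAux A P (p + q))
      (g := D.evalAux A P p + D.evalAux A P q) fun x y => by simp) t)
    (fun c t p => DFunLike.congr_fun (HTensor.ext (f := D.evalAux A P (c • p))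
      (g := c • D.evalAux A P p) fun x y => by simp) t)

@[simp] theorem eval_tmul (D : Connection B P') (p' : P') (p : P) (ω : Omega A) :
    D.eval A P (tmul _ p ω) p' = tmul _ p (D.jMap ω p') :=
  D.evalAux_tmul p' p ω

theorem eval_smul_right (D : Connection B P') (a : A) (t : ModTensor A P (Omega A)) (p' : P') :
    D.eval A P (MulOpposite.op a • t) p' = D.eval A P t (a • p') :=
  DFunLike.congr_fun (HTensor.ext (f := D.evalAux A P p' ∘L HTensor.rmulL _ a)
    (g := D.evalAux A P (a • p')) fun x ω => by simp [HTensor.rmulL, jMap_smul_right]) t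

theorem eval_op_smul (D : Connection B P') (b : B) (t : ModTensor A P (Omega A)) (p' : P') :
    D.eval A P t (MulOpposite.op b • p') = MulOpposite.op b • D.eval A P t p' :=
  DFunLike.congr_fun (HTensor.ext (f := D.evalAux A P (MulOpposite.op b • p'))
    (g := HTensor.rmulL _ b ∘L D.evalAux A P p')
    fun x ω => by simp [HTensor.rmulL, jMap_op_smul]) t

theorem mnorm_eval_le (D : Connection B P') : ∃ C : ℝ, 0 ≤ C ∧
    ∀ {m k n : Type} [Fintype m] [Fintype k] [Fintype n] (t : Matrix m k (ModTensor A P (Omega A)))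
      (p' : Matrix k n P'), mnorm (mmul (D.eval A P) t p') ≤ C * (mnorm t * mnorm p') := by
  obtain ⟨C, hC, h⟩ := D.mnorm_jMap_le (A := A)
  refine ⟨C, hC, fun {m k n} _ _ _ t p' => ?_⟩
  have h0 : 0 ≤ mnorm p' := MatrixSeminorm.nonneg _ _
  rw [mul_comm (mnorm t), ← mul_assoc]
  refine HTensor.bound (fun t => mmul (D.eval A P) t p') (MatrixSeminorm.continuous_mmul_right _
    (fun p => (D.evalAux A P p).continuous) p') (fun l _ x ω => ?_) (mul_nonneg hC h0) t
  rw [mmul_assoc (β₃ := D.jMap) (β₄ := tmul _) (fun x ω p => D.eval_tmul p x ω)]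
  refine (mnorm_mmul_tmul_le _ _ _).trans ?_
  calc _ ≤ mnorm x * (C * (mnorm ω * mnorm p')) :=
        mul_le_mul_of_nonneg_left (h ω p') (MatrixSeminorm.nonneg _ _)
    _ = _ := by ring

/-- The bilinear map `(p, p') ↦ (-1) ^ ∂p p ⊗ ∇' (p') + ∇_δ (p) p'`, with values in
`P ⊗̃_A (P' ⊗̃_B Ω¹(B))`. -/
def prodBilin (D : Connection A P) (D' : Connection B P') :
    P →ₗ[ℂ] P' →ₗ[ℂ] ModTensor A P (ModTensor B P' (Omega B)) :=
  (tmul _).compl₁₂ Graded.grade D'.toFun + (D'.eval A P) ∘ₗ D.toFun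

theorem prodBilin_apply (D : Connection A P) (D' : Connection B P') (p : P) (p' : P') :
    prodBilin D D' p p' = tmul _ (Graded.grade p) (D'.toFun p') + D'.eval A P (D.toFun p) p' := rfl

theorem prodBilin_balanced (D : Connection A P) (D' : Connection B P') (p : P) (a : A) (p' : P') :
    prodBilin D D' (MulOpposite.op a • p) p' = prodBilin D D' p (a • p') := by
  rw [prodBilin_apply, prodBilin_apply, D.leibniz, map_add, LinearMap.add_apply, eval_smul_right,
    eval_tmul, jMap_d, RightOperatorModule.grade_smul, tmul_balanced, map_sub]
  abel

theorem prodBilin_op_smul (D : Connection A P) (D' : Connection B P') (p : P) (b : B) (p' : P') :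
    prodBilin D D' p (MulOpposite.op b • p') = MulOpposite.op b • prodBilin D D' p p' +
      tmul _ (Graded.grade p) (tmul _ (Graded.grade p') (Omega.d b)) := by
  rw [prodBilin_apply, prodBilin_apply, D'.leibniz, map_add, eval_op_smul, smul_add, op_smul_tmul]
  abel

theorem mnorm_prodBilin_le (D : Connection A P) (D' : Connection B P') : ∃ C : ℝ, 0 ≤ C ∧
    ∀ {m k n : Type} [Fintype m] [Fintype k] [Fintype n] (p : Matrix m k P)
      (p' : Matrix k n P'), mnorm (mmul (prodBilin D D') p p') ≤ C * (mnorm p * mnorm p') := by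
  obtain ⟨C₁, h₁, h₁'⟩ := D'.mnorm_eval_le (A := A) (P := P)
  obtain ⟨C₂, h₂, h₂'⟩ := D'.completelyBounded.exists_nonneg
  obtain ⟨C₃, h₃, h₃'⟩ := D.completelyBounded.exists_nonneg
  refine ⟨C₂ + C₁ * C₃, by positivity, fun p p' => ?_⟩
  have e : mmul (prodBilin D D') p p' =
      mmul (tmul _) (p.map Graded.grade) (p'.map D'.toFun) +
        mmul (D'.eval A P) (p.map D.toFun) p' := by
    ext i j
    simp [mmul, prodBilin_apply, Finset.sum_add_distrib]
  have hp : 0 ≤ mnorm p := MatrixSeminorm.nonneg _ _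
  have hp' : 0 ≤ mnorm p' := MatrixSeminorm.nonneg _ _
  rw [e, add_mul]
  refine (MatrixSeminorm.add_le _ _ _).trans (add_le_add ?_ ?_)
  · refine (mnorm_mmul_tmul_le _ _ _).trans ?_
    rw [Graded.mnorm_grade]
    calc _ ≤ mnorm p * (C₂ * mnorm p') := mul_le_mul_of_nonneg_left (h₂' p') hp
      _ = _ := by ring
  · refine (h₁' _ _).trans ?_
    calc _ ≤ C₁ * ((C₃ * mnorm p) * mnorm p') :=
          mul_le_mul_of_nonneg_left (mul_le_mul_of_nonneg_right (h₃' p) hp') h₁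
      _ = _ := by ring

/-- The map underlying the product connection:
`p ⊗ p' ↦ (-1) ^ ∂p p ⊗ ∇' (p') + ∇_δ (p) p'`. -/
def prodMap (D : Connection A P) (D' : Connection B P') :
    ModTensor A P P' →L[ℂ] ModTensor B (ModTensor A P P') (Omega B) :=
  assoc A B P P' (Omega B) ∘L HTensor.lift (rel A P P') (prodBilin D D')
    (rel_le_ker (prodBilin_balanced D D'))
    (by
      obtain ⟨C, -, h⟩ := mnorm_prodBilin_le D D'
      exact ⟨C, fun k _ p p' => (norm_entry_le _ _ _).trans (h p p')⟩)

@[simp] theorem prodMap_tmul (D : Connection A P) (D' : Connection B P') (p : P) (p' : P') :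
    prodMap D D' (tmul _ p p') = assoc A B P P' (Omega B)
      (tmul _ (Graded.grade p) (D'.toFun p') + D'.eval A P (D.toFun p) p') :=
  congrArg _ (HTensor.lift_tmul _ _ _ _ _)

/-- The product connection `∇ ⊗̃_A ∇'` on `P ⊗̃_A P'`. -/
def prod (D : Connection A P) (D' : Connection B P') : Connection B (ModTensor A P P') where
  toFun := (prodMap D D').toLinearMap
  completelyBounded := by
    obtain ⟨C, hC, h⟩ := mnorm_prodBilin_le D D'
    refine ⟨C, fun u => HTensor.bound _ (continuous_map_clm (prodMap D D'))
      (fun k _ p p' => ?_) hC u⟩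
    have e : (mmul (tmul (rel A P P')) p p').map (prodMap D D') =
        (mmul (prodBilin D D') p p').map (assoc A B P P' (Omega B)) := by
      rw [mmul_map (β' := (prodBilin D D').compr₂ (assoc A B P P' (Omega B)).toLinearMap)
        (map_zero _) (map_add _) (prodMap_tmul D D')]
      exact (mmul_map (map_zero _) (map_add _) (fun _ _ => rfl) _ _).symm
    rw [e]
    exact (mnorm_assoc_le A B _).trans (h p p')
  leibniz t b := by
    refine DFunLike.congr_fun (HTensor.ext (f := prodMap D D' ∘L HTensor.rmulL _ b)
      (g := HTensor.rmulL _ b ∘L prodMap D D' +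
        (⟨(tmul (rel B (ModTensor A P P') (Omega B))).flip (Omega.d b) ∘ₗ Graded.grade, ?_⟩ :
          ModTensor A P P' →L[ℂ] ModTensor B (ModTensor A P P') (Omega B))) fun p p' => ?_) t
    · refine AddMonoidHomClass.continuous_of_bound
        ((tmul (rel B (ModTensor A P P') (Omega B))).flip (Omega.d b) ∘ₗ Graded.grade)
        ‖Omega.d b‖ fun s => ?_
      have h1 := mnorm_mmul_tmul_le (rel B (ModTensor A P P') (Omega B)) (unit (Graded.grade s))
        (unit (Omega.d b))
      have e1 : mmul (tmul (rel B (ModTensor A P P') (Omega B))) (unit (Graded.grade s))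
          (unit (Omega.d b)) = unit (tmul _ (Graded.grade s) (Omega.d b)) := by
        ext; simp [mmul]
      have h2 : mnorm (unit (Graded.grade s)) = mnorm (unit s) := Graded.mnorm_grade (unit s)
      rw [e1, h2, mnorm_unit, mnorm_unit, mnorm_unit,
        mul_comm] at h1
      exact h1
    · change prodMap D D' (MulOpposite.op b • tmul _ p p') =
        MulOpposite.op b • prodMap D D' (tmul _ p p') +
          tmul (rel B (ModTensor A P P') (Omega B)) (Graded.grade (tmul _ p p')) (Omega.d b)
      rw [op_smul_tmul, prodMap_tmul, prodMap_tmul, ← assoc_op_smul, ← prodBilin_apply,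
        prodBilin_op_smul, map_add, ← prodBilin_apply, grade_tmul, assoc_tmul, assocBilin_tmul]

end Connection

end Connections

/-! ## Intertwining of connections -/

section Intertwining

variable {C : Type*} [NormedRing C] [NormedAlgebra ℂ C] [OperatorSpace C] [Graded C]
variable {M M' : Type*}
  [NormedAddCommGroup M] [NormedSpace ℂ M] [OperatorSpace M] [Graded M]
  [Module Cᵐᵒᵖ M] [IsScalarTower ℂ Cᵐᵒᵖ M] [RightOperatorModule C M]
  [NormedAddCommGroup M'] [NormedSpace ℂ M'] [OperatorSpace M'] [Graded M']
  [Module Cᵐᵒᵖ M'] [IsScalarTower ℂ Cᵐᵒᵖ M'] [RightOperatorModule C M']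

/-- The map `f ⊗ 1 : M ⊗̃_C W → M' ⊗̃_C W` for a completely bounded right module map `f`. -/
def mapLeft (f : M →ₗ[ℂ] M') (hf : CompletelyBounded f)
    (hC : ∀ (c : C) (x : M), f (MulOpposite.op c • x) = MulOpposite.op c • f x)
    (W : Type*) [NormedAddCommGroup W] [NormedSpace ℂ W] [OperatorSpace W] [Module C W] :
    ModTensor C M W →L[ℂ] ModTensor C M' W :=
  HTensor.map (rel C M W) (rel C M' W) f LinearMap.id
    (rel_le_comap id (fun x c => hC c x) (fun _ _ => rfl))
    (by
      obtain ⟨K, hK, h⟩ := hf.exists_nonneg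
      exact rcBounded_of_le (fun _ _ x => h x) (fun _ _ w => mnorm_map_id_le w) hK)

/-- A completely bounded right module map `f : M → M'` intertwines the connections `D` and `D'` if
`D' ∘ f = (f ⊗ 1) ∘ D`. -/
def Intertwines [OperatorAlgebra C] (f : M →ₗ[ℂ] M') (hf : CompletelyBounded f)
    (hC : ∀ (c : C) (x : M), f (MulOpposite.op c • x) = MulOpposite.op c • f x)
    (D : Connection C M) (D' : Connection C M') : Prop :=
  ∀ x : M, D'.toFun (f x) = mapLeft f hf hC (Omega C) (D.toFun x)

end Intertwining

theorem completelyBounded_assoc (A B : Type*) [NormedRing A] [NormedAlgebra ℂ A] [OperatorSpace A]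
    [Graded A] [NormedRing B] [NormedAlgebra ℂ B] [OperatorSpace B] [Graded B]
    (X Y Z : Type*) [NormedAddCommGroup X] [NormedSpace ℂ X] [OperatorSpace X] [Graded X]
    [Module Aᵐᵒᵖ X] [IsScalarTower ℂ Aᵐᵒᵖ X] [RightOperatorModule A X]
    [NormedAddCommGroup Y] [NormedSpace ℂ Y] [OperatorSpace Y] [Graded Y]
    [Module A Y] [IsScalarTower ℂ A Y] [LeftOperatorModule A Y]
    [Module Bᵐᵒᵖ Y] [IsScalarTower ℂ Bᵐᵒᵖ Y] [RightOperatorModule B Y] [SMulCommClass A Bᵐᵒᵖ Y]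
    [NormedAddCommGroup Z] [NormedSpace ℂ Z] [OperatorSpace Z] [Graded Z]
    [Module B Z] [IsScalarTower ℂ B Z] [LeftOperatorModule B Z] :
    CompletelyBounded (assoc A B X Y Z).toLinearMap :=
  ⟨1, fun u => (mnorm_assoc_le A B u).trans (one_mul _).ge⟩

end OpMod

end

open OpMod

noncomputable section

namespace OpMod

open scoped TensorProduct

/-! ### Elementary tensors as bounded maps in each variable -/

section ElementaryTensors

variable {X Y : Type*} [NormedAddCommGroup X] [NormedSpace ℂ X] [OperatorSpace X]
  [NormedAddCommGroup Y] [NormedSpace ℂ Y] [OperatorSpace Y]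

/-! Associativity of the module Haagerup product rests on the matrix identity (x ⊙ y) ⊙ z = x ⊙ (y ⊙
z). The Haagerup norm is an infimum over such factorizations, so regrouping is completely
contractive in either direction. The map `assoc` is already known to be completely contractive. Its
mirror image `assocInv` is built by fixing z instead of x, and the two are inverse to each other.
Mutually inverse complete contractions are complete isometries (`mnorm_assoc`). Compatibility with
gradings and actions is seen on elementary tensors.

For the connections, write γ for the grading. Both sides of the intertwining identity are bounded,
so it is enough to compare them on p ⊗ (p' ⊗ p''). Up to regrouping, each product connection then
gives three terms: γp ⊗ γp' ⊗ ∇''p'', then γp ⊗ ∇'_δ(p')p'', and a term that contains ∇p. The first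
two match by the pentagon identity for four factors (`assocMapLeft_tmul_assoc_tmul`) and by its
version with forms evaluated (`assoc_eval_assoc_tmul`).

The third term is the heart of the matter. On one side, ∇p is paired with p' through ∇' and the
result with p'' through ∇''. On the other side, ∇p is paired with p' ⊗ p'' at once through ∇' ⊗ ∇''.
These agree because j_δ of a product connection is the successive evaluation (`jMap_prod_tmul`).
Indeed j_δ is the restriction to Ω¹(A) of a ⊗ b ↦ a∇b, and for ∇ = ∇' ⊗ ∇'' the Leibniz-type formula
gives a∇(bp' ⊗ p'') = aγ(b)γ(p') ⊗ ∇''p'' + (the form a∇'(bp') evaluated on p''). The coefficient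
aγ(b) is the graded multiplication of a ⊗ b, so the unwanted first term is zero exactly where the
graded multiplication is, namely on Ω¹(A) (`jAux_prod_tmul`).

All identities between bounded maps are reduced by `HTensor.ext` to elementary tensors, once for
each nested tensor product. The maps `tmulL` and `tmulFlipL` supply the boundedness that this needs.
-/

theorem norm_tmul_le (N : Submodule ℂ (X ⊗[ℂ] Y)) (x : X) (y : Y) :
    ‖tmul N x y‖ ≤ ‖x‖ * ‖y‖ := by
  rw [← mnorm_unit, ← mnorm_unit x, ← mnorm_unit y]
  -- The 1 × 1 case of the matrix inequality.
  refine le_of_eq_of_le ?_ (mnorm_mmul_tmul_le N (unit x) (unit y))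
  congr 1
  ext i j
  simp [mmul]

/-- The bounded linear map `y ↦ x ⊗ y`. -/
def tmulL (N : Submodule ℂ (X ⊗[ℂ] Y)) (x : X) : Y →L[ℂ] HTensor N :=
  (tmul N x).mkContinuous ‖x‖ (norm_tmul_le N x)

/-- The bounded linear map `x ↦ x ⊗ y`. -/
def tmulFlipL (N : Submodule ℂ (X ⊗[ℂ] Y)) (y : Y) : X →L[ℂ] HTensor N :=
  ((tmul N).flip y).mkContinuous ‖y‖ fun x => (norm_tmul_le N x y).trans_eq (mul_comm _ _)

@[simp] theorem tmulL_apply (N : Submodule ℂ (X ⊗[ℂ] Y)) (x : X) (y : Y) :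
    tmulL N x y = tmul N x y := rfl

@[simp] theorem tmulFlipL_apply (N : Submodule ℂ (X ⊗[ℂ] Y)) (x : X) (y : Y) :
    tmulFlipL N y x = tmul N x y := rfl

end ElementaryTensors

/-! ### The inverse associator; complete isometry, grading and actions -/

section AssocInv

variable (A B : Type*) [NormedRing A] [NormedAlgebra ℂ A] [OperatorSpace A] [Graded A]
  [NormedRing B] [NormedAlgebra ℂ B] [OperatorSpace B] [Graded B]
variable (X Y Z : Type*)
  [NormedAddCommGroup X] [NormedSpace ℂ X] [OperatorSpace X] [Graded X]
  [Module Aᵐᵒᵖ X] [IsScalarTower ℂ Aᵐᵒᵖ X] [RightOperatorModule A X]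
  [NormedAddCommGroup Y] [NormedSpace ℂ Y] [OperatorSpace Y] [Graded Y]
  [Module A Y] [IsScalarTower ℂ A Y] [LeftOperatorModule A Y]
  [Module Bᵐᵒᵖ Y] [IsScalarTower ℂ Bᵐᵒᵖ Y] [RightOperatorModule B Y] [SMulCommClass A Bᵐᵒᵖ Y]
  [NormedAddCommGroup Z] [NormedSpace ℂ Z] [OperatorSpace Z] [Graded Z]
  [Module B Z] [IsScalarTower ℂ B Z] [LeftOperatorModule B Z]

variable {Z} in
/-- The map `x ⊗ y ↦ x ⊗ (y ⊗ z)` for fixed `z`. -/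
def assocInvAux (z : Z) : ModTensor A X Y →L[ℂ] ModTensor A X (ModTensor B Y Z) :=
  HTensor.map (rel A X Y) (rel A X (ModTensor B Y Z)) LinearMap.id ((tmul (rel B Y Z)).flip z)
    -- Relations over `A` go to relations over `A`, since y ↦ y ⊗ z is left `A`-linear: a(y ⊗ z) is
    -- (ay) ⊗ z by definition of the action.
    (rel_le_comap id (fun _ _ => rfl) (fun a y => (smul_tmul _ a y z).symm))
    (rcBounded_of_le (D := ‖z‖) (fun _ _ x => mnorm_map_id_le x) (fun k _ y => by
      -- The column with entries y_s ⊗ z is the product of the column y with the 1 × 1 matrix z,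
      -- which is why the constant is ‖z‖.
      rw [← mnorm_unit, mul_comm]
      refine le_of_eq_of_le ?_ (mnorm_mmul_tmul_le (rel B Y Z) y (unit z))
      congr 1
      ext i j
      simp [mmul]) zero_le_one)

variable {X Y Z} in
@[simp] theorem assocInvAux_tmul (x : X) (y : Y) (z : Z) :
    assocInvAux A B X Y z (tmul _ x y) = tmul _ x (tmul _ y z) :=
  HTensor.map_tmul _ _ _ _ _ _ _ _

/-- The bilinear map `(x ⊗ y, z) ↦ x ⊗ (y ⊗ z)`. -/
def assocInvBilin : ModTensor A X Y →ₗ[ℂ] Z →ₗ[ℂ] ModTensor A X (ModTensor B Y Z) :=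
  LinearMap.mk₂ ℂ (fun t z => assocInvAux A B X Y z t)
    (fun s t z => map_add (assocInvAux A B X Y z) s t)
    (fun c t z => map_smul (assocInvAux A B X Y z) c t)
    -- Linearity in t is that of a single bounded map. Linearity in z relates different maps, so it
    -- is tested on elementary tensors x ⊗ y.
    (fun t z z' => DFunLike.congr_fun (HTensor.ext (f := assocInvAux A B X Y (z + z'))
      (g := assocInvAux A B X Y z + assocInvAux A B X Y z') fun x y => by simp) t)
    (fun c t z => DFunLike.congr_fun (HTensor.ext (f := assocInvAux A B X Y (c • z))
      (g := c • assocInvAux A B X Y z) fun x y => by simp) t)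

variable {X Y Z} in
@[simp] theorem assocInvBilin_tmul (x : X) (y : Y) (z : Z) :
    assocInvBilin A B X Y Z (tmul _ x y) z = tmul _ x (tmul _ y z) :=
  assocInvAux_tmul A B x y z

/-- With z fixed, the bound only has to be tested on t = x ⊙ y. There, regrouping to x ⊙ (y ⊙ z) and
applying the Haagerup inequality twice gives ‖x‖ ‖y‖ ‖z‖, with no loss in the constant. -/
theorem mnorm_assocInvBilin_le {m k n : Type} [Fintype m] [Fintype k] [Fintype n]
    (t : Matrix m k (ModTensor A X Y)) (z : Matrix k n Z) :
    mnorm (mmul (assocInvBilin A B X Y Z) t z) ≤ mnorm t * mnorm z := by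
  -- `HTensor.bound` expects the constant on the left; here the constant is the norm of z.
  rw [mul_comm]
  refine HTensor.bound (fun t => mmul (assocInvBilin A B X Y Z) t z)
    (MatrixSeminorm.continuous_mmul_right _ (fun z => (assocInvAux A B X Y z).continuous) z)
    (fun l _ x y => ?_) (MatrixSeminorm.nonneg _ _) t
  rw [mmul_assoc (β₃ := tmul (rel B Y Z)) (β₄ := tmul (rel A X (ModTensor B Y Z)))
    (fun x y z => assocInvBilin_tmul A B x y z), mul_comm, mul_assoc]
  exact (mnorm_mmul_tmul_le _ _ _).trans (mul_le_mul_of_nonneg_left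
    (mnorm_mmul_tmul_le _ y z) (MatrixSeminorm.nonneg _ _))

/-- The natural map `(X ⊗̃_A Y) ⊗̃_B Z → X ⊗̃_A (Y ⊗̃_B Z)`, `(x ⊗ y) ⊗ z ↦ x ⊗ (y ⊗ z)`. -/
def assocInv : ModTensor B (ModTensor A X Y) Z →L[ℂ] ModTensor A X (ModTensor B Y Z) :=
  HTensor.lift (rel B (ModTensor A X Y) Z) (assocInvBilin A B X Y Z)
    -- Balancing over `B`: on t = x ⊗ y the claim is x ⊗ (yb ⊗ z) = x ⊗ (y ⊗ bz), the relation
    -- inside the inner factor. The general t follows by density.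
    (rel_le_ker fun t b z => DFunLike.congr_fun
      (HTensor.ext (f := assocInvAux A B X Y z ∘L HTensor.rmulL _ b)
        (g := assocInvAux A B X Y (b • z))
        fun x y => by simp [HTensor.rmulL, tmul_balanced]) t)
    ⟨1, fun k _ t z => (norm_entry_le _ _ _).trans (by
      rw [one_mul]
      exact mnorm_assocInvBilin_le A B X Y Z t z)⟩

variable {X Y Z}

@[simp] theorem assocInv_tmul (t : ModTensor A X Y) (z : Z) :
    assocInv A B X Y Z (tmul _ t z) = assocInvBilin A B X Y Z t z :=
  HTensor.lift_tmul _ _ _ _ _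

/-- The constant 1 matters: together with `mnorm_assoc_le` it turns an isomorphism into a complete
isometry. -/
theorem mnorm_assocInv_le {m n : Type} [Fintype m] [Fintype n]
    (u : Matrix m n (ModTensor B (ModTensor A X Y) Z)) :
    mnorm (u.map (assocInv A B X Y Z)) ≤ mnorm u := by
  rw [← one_mul (mnorm u)]
  refine HTensor.bound _ (continuous_map_clm _) (fun k _ t z => ?_) zero_le_one u
  rw [mmul_map (β' := assocInvBilin A B X Y Z) (map_zero _) (map_add _) (assocInv_tmul A B),
    one_mul]
  exact mnorm_assocInvBilin_le A B X Y Z t z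

/-- Two density arguments are needed, because an elementary tensor x ⊗ s still has an arbitrary
second factor s in a completed tensor product. -/
theorem assocInv_assoc (t : ModTensor A X (ModTensor B Y Z)) :
    assocInv A B X Y Z (assoc A B X Y Z t) = t := by
  refine DFunLike.congr_fun (HTensor.ext (f := assocInv A B X Y Z ∘L assoc A B X Y Z)
    (g := ContinuousLinearMap.id ℂ _) fun x s => ?_) t
  change assocInv A B X Y Z (assoc A B X Y Z (tmul _ x s)) = tmul _ x s
  rw [assoc_tmul]
  induction s using HTensor.induction with
  | hp =>
    -- For fixed x, both sides are continuous in s: `assocBilin` at x is `assocAux`, and s ↦ x ⊗ s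
    -- is bounded.
    refine isClosed_eq ((assocInv A B X Y Z).continuous.comp (assocAux A B Y Z x).continuous)
      (tmulL _ x).continuous
  | h0 => simp
  | htmul y z => simp
  | hadd s t hs ht => simp only [map_add, hs, ht]

/-- The mirror argument: here the first factor of an elementary tensor is the one that calls for the
second density step. -/
theorem assoc_assocInv (t : ModTensor B (ModTensor A X Y) Z) :
    assoc A B X Y Z (assocInv A B X Y Z t) = t := by
  refine DFunLike.congr_fun (HTensor.ext (f := assoc A B X Y Z ∘L assocInv A B X Y Z)
    (g := ContinuousLinearMap.id ℂ _) fun s z => ?_) t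
  change assoc A B X Y Z (assocInv A B X Y Z (tmul _ s z)) = tmul _ s z
  rw [assocInv_tmul]
  induction s using HTensor.induction with
  | hp =>
    refine isClosed_eq ((assoc A B X Y Z).continuous.comp (assocInvAux A B X Y z).continuous)
      (tmulFlipL _ z).continuous
  | h0 => simp
  | htmul x y => simp
  | hadd s t hs ht => simp only [map_add, LinearMap.add_apply, hs, ht]

theorem assoc_bijective : Function.Bijective (assoc A B X Y Z) :=
  Function.bijective_iff_has_inverse.2
    ⟨assocInv A B X Y Z, assocInv_assoc A B, assoc_assocInv A B⟩

/-- A complete contraction with a completely contractive left inverse preserves all matrix norms. -/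
theorem mnorm_assoc {m n : Type} [Fintype m] [Fintype n]
    (u : Matrix m n (ModTensor A X (ModTensor B Y Z))) :
    mnorm (u.map (assoc A B X Y Z)) = mnorm u := by
  refine le_antisymm (mnorm_assoc_le A B u) ?_
  refine le_of_eq_of_le ?_ (mnorm_assocInv_le A B (u.map (assoc A B X Y Z)))
  congr 1
  ext i j
  exact (assocInv_assoc A B _).symm

/-- Each grading is γ ⊗ γ, so on triple elementary tensors both sides apply γ to every factor. -/
theorem assoc_grade (t : ModTensor A X (ModTensor B Y Z)) :
    assoc A B X Y Z (Graded.grade t) = Graded.grade (assoc A B X Y Z t) := by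
  refine DFunLike.congr_fun (HTensor.ext (f := assoc A B X Y Z ∘L HTensor.gradeL _)
    (g := HTensor.gradeL _ ∘L assoc A B X Y Z) fun x s => ?_) t
  change assoc A B X Y Z (Graded.grade (tmul _ x s)) =
    Graded.grade (assoc A B X Y Z (tmul _ x s))
  rw [grade_tmul, assoc_tmul, assoc_tmul]
  refine DFunLike.congr_fun (HTensor.ext
    (f := assocAux A B Y Z (Graded.grade x) ∘L HTensor.gradeL (rel B Y Z))
    (g := HTensor.gradeL (rel B (ModTensor A X Y) Z) ∘L assocAux A B Y Z x) fun y z => ?_) s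
  simp [HTensor.gradeL_tmul]

/-- Linearity for a left action on the outermost factor. It is what lets the coefficient a in a∇b
pass through the associator hidden in a product connection. -/
theorem assoc_smul {C : Type*} [NormedRing C] [NormedAlgebra ℂ C] [OperatorSpace C] [Graded C]
    [Module C X] [IsScalarTower ℂ C X] [LeftOperatorModule C X] [SMulCommClass C Aᵐᵒᵖ X]
    (c : C) (t : ModTensor A X (ModTensor B Y Z)) :
    assoc A B X Y Z (c • t) = c • assoc A B X Y Z t := by
  refine DFunLike.congr_fun (HTensor.ext (f := assoc A B X Y Z ∘L HTensor.lmulL _ c)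
    (g := HTensor.lmulL _ c ∘L assoc A B X Y Z) fun x s => ?_) t
  change assoc A B X Y Z (c • tmul _ x s) = c • assoc A B X Y Z (tmul _ x s)
  rw [smul_tmul, assoc_tmul, assoc_tmul]
  refine DFunLike.congr_fun (HTensor.ext (f := assocAux A B Y Z (c • x))
    (g := HTensor.lmulL (rel B (ModTensor A X Y) Z) c ∘L assocAux A B Y Z x) fun y z => ?_) s
  simp [HTensor.lmulL]

end AssocInv

/-! ### Fourfold tensor products and the pentagon identity -/

section ProductConnections

variable {A B C P P' P'' : Type*}
  [NormedRing A] [NormedAlgebra ℂ A] [OperatorSpace A] [Graded A]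
  [NormedRing B] [NormedAlgebra ℂ B] [OperatorSpace B] [Graded B]
  [NormedRing C] [NormedAlgebra ℂ C] [OperatorSpace C] [Graded C]
  [NormedAddCommGroup P] [NormedSpace ℂ P] [OperatorSpace P] [Graded P]
  [Module Aᵐᵒᵖ P] [IsScalarTower ℂ Aᵐᵒᵖ P] [RightOperatorModule A P]
  [NormedAddCommGroup P'] [NormedSpace ℂ P'] [OperatorSpace P'] [Graded P']
  [Module A P'] [IsScalarTower ℂ A P'] [LeftOperatorModule A P']
  [Module Bᵐᵒᵖ P'] [IsScalarTower ℂ Bᵐᵒᵖ P'] [RightOperatorModule B P']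
  [SMulCommClass A Bᵐᵒᵖ P']
  [NormedAddCommGroup P''] [NormedSpace ℂ P''] [OperatorSpace P''] [Graded P'']
  [Module B P''] [IsScalarTower ℂ B P''] [LeftOperatorModule B P'']
  [Module Cᵐᵒᵖ P''] [IsScalarTower ℂ Cᵐᵒᵖ P''] [RightOperatorModule C P'']
  [SMulCommClass B Cᵐᵒᵖ P'']

variable (A B C P P' P'') in
/-- The natural map `P ⊗̃_A ((P' ⊗̃_B P'') ⊗̃_C W) → ((P ⊗̃_A P') ⊗̃_B P'') ⊗̃_C W`. -/
def assocMapLeft (W : Type*) [NormedAddCommGroup W] [NormedSpace ℂ W] [OperatorSpace W] [Graded W]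
    [Module C W] [IsScalarTower ℂ C W] [LeftOperatorModule C W] :
    ModTensor A P (ModTensor C (ModTensor B P' P'') W) →L[ℂ]
      ModTensor C (ModTensor B (ModTensor A P P') P'') W :=
  -- The associator applied first is the one built into the product of ∇ with ∇' ⊗ ∇''; the map
  -- applied after it is Φ ⊗ 1. The composite thus collects every regrouping on one side of the
  -- intertwining identity.
  mapLeft (assoc A B P P' P'').toLinearMap (completelyBounded_assoc A B P P' P'')
    (assoc_op_smul A B) W ∘L assoc A C P (ModTensor B P' P'') W

/-- The pentagon identity, with the first two factors elementary. -/
theorem assocMapLeft_tmul_assoc_tmul {W : Type*} [NormedAddCommGroup W] [NormedSpace ℂ W]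
    [OperatorSpace W] [Graded W] [Module C W] [IsScalarTower ℂ C W] [LeftOperatorModule C W]
    (p : P) (p' : P') (s : ModTensor C P'' W) :
    assocMapLeft A B C P P' P'' W (tmul _ p (assoc B C P' P'' W (tmul _ p' s))) =
      assoc B C (ModTensor A P P') P'' W (tmul _ (tmul _ p p') s) := by
  change mapLeft _ _ _ W (assoc A C P (ModTensor B P' P'') W (tmul _ p _)) = _
  rw [assoc_tmul, assoc_tmul, assoc_tmul]
  -- With p and p' fixed, both sides are bounded in s. On s = p'' ⊗ w both equal ((p ⊗ p') ⊗ p'') ⊗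
  -- w.
  refine DFunLike.congr_fun (HTensor.ext
    (f := mapLeft (assoc A B P P' P'').toLinearMap (completelyBounded_assoc A B P P' P'')
      (assoc_op_smul A B) W ∘L assocAux A C (ModTensor B P' P'') W p ∘L assocAux B C P'' W p')
    (g := assocAux B C P'' W (tmul _ p p')) fun p'' w => ?_) s
  simp [mapLeft]

/-! ### Evaluation of forms and the intertwining identity -/

namespace Connection

variable [OperatorAlgebra A] [OperatorAlgebra B] [OperatorAlgebra C]

/-- Evaluation of forms is compatible with associativity. -/
theorem assoc_eval_assoc_tmul (D'' : Connection C P'') (p : P)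
    (u : ModTensor B P' (Omega B)) (p'' : P'') :
    assoc B C (ModTensor A P P') P'' (Omega C)
        (D''.eval B (ModTensor A P P') (assoc A B P P' (Omega B) (tmul _ p u)) p'') =
      assocMapLeft A B C P P' P'' (Omega C)
        (tmul _ p (assoc B C P' P'' (Omega C) (D''.eval B P' u p''))) := by
  rw [assoc_tmul]
  -- For u = p' ⊗ η, evaluation replaces η by s = j_δ(η)p'' on both sides and leaves p and p' alone.
  -- What remains is the pentagon identity for p, p' and s.
  refine DFunLike.congr_fun (HTensor.ext
    (f := assoc B C (ModTensor A P P') P'' (Omega C) ∘L D''.evalAux B (ModTensor A P P') p'' ∘L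
      assocAux A B P' (Omega B) p)
    (g := assocMapLeft A B C P P' P'' (Omega C) ∘L tmulL _ p ∘L
      assoc B C P' P'' (Omega C) ∘L D''.evalAux B P' p'') fun p' η => ?_) u
  simp only [ContinuousLinearMap.comp_apply, assocAux_tmul, evalAux_tmul, tmulL_apply]
  exact (assocMapLeft_tmul_assoc_tmul p p' _).symm

/-- The left action moves only the factor in `P'`, while evaluation changes only the form. The two
therefore commute. -/
theorem eval_smul_left (D'' : Connection C P'') (a : A) (u : ModTensor B P' (Omega B)) (p'' : P'') :
    D''.eval B P' (a • u) p'' = a • D''.eval B P' u p'' :=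
  DFunLike.congr_fun (HTensor.ext (f := D''.evalAux B P' p'' ∘L HTensor.lmulL _ a)
    (g := HTensor.lmulL _ a ∘L D''.evalAux B P' p'')
    fun x η => by simp [HTensor.lmulL]) u

/-- `prodMap_tmul` in a form that rewrites under the bundled connection, as iterated products
require. -/
theorem prod_toFun_tmul (D : Connection A P) (D' : Connection B P') (p : P) (p' : P') :
    (D.prod D').toFun (tmul _ p p') = assoc A B P P' (Omega B)
      (tmul _ (Graded.grade p) (D'.toFun p') + D'.eval A P (D.toFun p) p') :=
  prodMap_tmul D D' p p'

/-- The formula is stated on all of A ⊗̃ A, where elementary tensors a ⊗ b are available; elements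
of Ω¹(A) need not be limits of elementary tensors lying in Ω¹(A). The price is the first summand,
whose coefficient is the graded multiplication of t. -/
theorem jAux_prod_tmul (D' : Connection B P') (D'' : Connection C P'') (p' : P') (p'' : P'')
    (t : PlainTensor A A) :
    (D'.prod D'').jAux (tmul _ p' p'') t = assoc B C P' P'' (Omega C)
      (tmul _ (gradedMul A t • Graded.grade p') (D''.toFun p'') +
        D''.eval B P' (D'.jAux p' t) p'') := by
  -- Needed to write the first summand as a bounded map in t, so that `HTensor.ext` applies; the
  -- bound is the 1 × 1 case of the contractive action.
  have hc : Continuous fun a : A => a • Graded.grade p' := by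
    refine AddMonoidHomClass.continuous_of_bound ((lact A P').flip (Graded.grade p'))
      ‖Graded.grade p'‖ fun a => ?_
    have h := LeftOperatorModule.mnorm_smul_le (unit a) (unit (Graded.grade p'))
    have e : mmul (lact A P') (unit a) (unit (Graded.grade p')) = unit (a • Graded.grade p') := by
      ext; simp [mmul]
    rw [e, mnorm_unit, mnorm_unit, mnorm_unit, mul_comm] at h
    exact h
  refine DFunLike.congr_fun (HTensor.ext (f := (D'.prod D'').jAux (tmul _ p' p''))
    (g := assoc B C P' P'' (Omega C) ∘L (tmulFlipL _ (D''.toFun p'') ∘L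
      (⟨(lact A P').flip (Graded.grade p'), hc⟩ : A →L[ℂ] P') ∘L gradedMul A +
        D''.evalAux B P' p'' ∘L D'.jAux p')) fun a b => ?_) t
  change (D'.prod D'').jAux (tmul _ p' p'') (tmul ⊥ a b) = assoc B C P' P'' (Omega C)
      (tmul _ (gradedMul A (tmul ⊥ a b) • Graded.grade p') (D''.toFun p'') +
        D''.evalAux B P' p'' (D'.jAux p' (tmul ⊥ a b)))
  -- On a ⊗ b, the element b is absorbed into p' before the product formula is applied, and a is
  -- then carried inside the associator and the evaluation. The sign γ(bp') = γ(b)γ(p') produces the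
  -- coefficient aγ(b), the graded multiplication of a ⊗ b.
  rw [jAux_tmul, jAux_tmul, smul_tmul, prod_toFun_tmul, ← assoc_smul, smul_add, smul_tmul,
    gradedMul_tmul, LeftOperatorModule.grade_smul, mul_smul, ← eval_smul_left]
  rfl

/-- `j_δ` for a product connection. -/
theorem jMap_prod_tmul (D' : Connection B P') (D'' : Connection C P'') (ω : Omega A) (p' : P')
    (p'' : P'') :
    (D'.prod D'').jMap ω (tmul _ p' p'') =
      assoc B C P' P'' (Omega C) (D''.eval B P' (D'.jMap ω p') p'') := by
  have h := jAux_prod_tmul D' D'' p' p'' (Omega.incl A ω)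
  -- Universal forms lie in the kernel of the graded multiplication, so the summand with ∇''p''
  -- disappears.
  rw [Omega.gradedMul_incl, zero_smul, map_zero, LinearMap.zero_apply, zero_add] at h
  exact h

/-- Taken at t = ∇p, this matches the terms containing ∇p on the two sides. Allowing every t permits
a reduction to p ⊗ ω, where `jMap_prod_tmul` turns one evaluation on p' ⊗ p'' into two successive
ones. -/
theorem assocMapLeft_eval_prod (D' : Connection B P') (D'' : Connection C P'')
    (t : ModTensor A P (Omega A)) (p' : P') (p'' : P'') :
    assocMapLeft A B C P P' P'' (Omega C) ((D'.prod D'').eval A P t (tmul _ p' p'')) =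
      assoc B C (ModTensor A P P') P'' (Omega C)
        (D''.eval B (ModTensor A P P') (assoc A B P P' (Omega B) (D'.eval A P t p')) p'') := by
  refine DFunLike.congr_fun (HTensor.ext
    (f := assocMapLeft A B C P P' P'' (Omega C) ∘L (D'.prod D'').evalAux A P (tmul _ p' p''))
    (g := assoc B C (ModTensor A P P') P'' (Omega C) ∘L D''.evalAux B (ModTensor A P P') p'' ∘L
      assoc A B P P' (Omega B) ∘L D'.evalAux A P p') fun p ω => ?_) t
  simp only [ContinuousLinearMap.comp_apply, evalAux_tmul, jMap_prod_tmul]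
  exact (assoc_eval_assoc_tmul D'' p _ p'').symm

/-- The associativity isomorphism intertwines the two product connections. -/
theorem intertwines_assoc (D : Connection A P) (D' : Connection B P') (D'' : Connection C P'') :
    Intertwines (assoc A B P P' P'').toLinearMap (completelyBounded_assoc A B P P' P'')
      (assoc_op_smul A B) (D.prod (D'.prod D'')) ((D.prod D').prod D'') := by
  -- Both sides are bundled as bounded maps so that extensionality can be used for the outer and
  -- then for the inner tensor product.
  let lhs : ModTensor A P (ModTensor B P' P'') →L[ℂ] _ :=
    prodMap (D.prod D') D'' ∘L assoc A B P P' P''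
  let rhs : ModTensor A P (ModTensor B P' P'') →L[ℂ] _ :=
    mapLeft (assoc A B P P' P'').toLinearMap (completelyBounded_assoc A B P P' P'')
      (assoc_op_smul A B) (Omega C) ∘L prodMap D (D'.prod D'')
  suffices h : lhs = rhs from fun x => DFunLike.congr_fun h x
  refine HTensor.ext fun p s => ?_
  refine DFunLike.congr_fun (HTensor.ext (f := lhs ∘L tmulL _ p) (g := rhs ∘L tmulL _ p)
    fun p' p'' => ?_) s
  change (((D.prod D').prod D'').toFun (assoc A B P P' P'' (tmul _ p (tmul _ p' p'')))) =
    mapLeft (assoc A B P P' P'').toLinearMap (completelyBounded_assoc A B P P' P'')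
      (assoc_op_smul A B) (Omega C) ((D.prod (D'.prod D'')).toFun (tmul _ p (tmul _ p' p'')))
  rw [assoc_tmul, assocBilin_tmul, prod_toFun_tmul (D.prod D') D'', prod_toFun_tmul D D',
    prod_toFun_tmul D (D'.prod D'')]
  -- Φ ⊗ 1 is merged with the associator in the definition of the outer product connection.
  change _ = assocMapLeft A B C P P' P'' (Omega C) _
  -- Each side splits into three terms, bracketed differently. `assocMapLeft_tmul_assoc_tmul`
  -- matches the term with ∇''p'', `assoc_eval_assoc_tmul` with u = ∇'p' the term with ∇'p', and
  -- `assocMapLeft_eval_prod` the term with ∇p; `add_assoc` reconciles the brackets.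
  rw [map_add, map_add (assocMapLeft A B C P P' P'' (Omega C)), assocMapLeft_eval_prod,
    prod_toFun_tmul D' D'', map_add (assoc A B P P' (Omega B)), map_add (D''.eval B _),
    LinearMap.add_apply, map_add, map_add (assoc B C P' P'' (Omega C)), map_add (tmul _ _), map_add,
    assocMapLeft_tmul_assoc_tmul, assoc_eval_assoc_tmul, grade_tmul, add_assoc]

end Connection

end ProductConnections

end OpMod

end

/-- Here `P` is a right operator `A`-module, `P'` an operator `(A, B)`-bimodule and `P''` an operator
`(B, C)`-bimodule, all with universal connections. The first block of the conclusion says that the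
natural map is an isomorphism of graded right operator `C`-modules, the last line that it intertwines
the two product connections. -/
theorem mainTheorem9 {A B C P P' P'' : Type*}
    [NormedRing A] [NormedAlgebra ℂ A] [OperatorSpace A] [Graded A] [OperatorAlgebra A]
    [NormedRing B] [NormedAlgebra ℂ B] [OperatorSpace B] [Graded B] [OperatorAlgebra B]
    [NormedRing C] [NormedAlgebra ℂ C] [OperatorSpace C] [Graded C] [OperatorAlgebra C]
    [NormedAddCommGroup P] [NormedSpace ℂ P] [OperatorSpace P] [Graded P]
    [Module Aᵐᵒᵖ P] [IsScalarTower ℂ Aᵐᵒᵖ P] [RightOperatorModule A P]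
    [NormedAddCommGroup P'] [NormedSpace ℂ P'] [OperatorSpace P'] [Graded P']
    [Module A P'] [IsScalarTower ℂ A P'] [LeftOperatorModule A P']
    [Module Bᵐᵒᵖ P'] [IsScalarTower ℂ Bᵐᵒᵖ P'] [RightOperatorModule B P']
    [SMulCommClass A Bᵐᵒᵖ P']
    [NormedAddCommGroup P''] [NormedSpace ℂ P''] [OperatorSpace P''] [Graded P'']
    [Module B P''] [IsScalarTower ℂ B P''] [LeftOperatorModule B P'']
    [Module Cᵐᵒᵖ P''] [IsScalarTower ℂ Cᵐᵒᵖ P''] [RightOperatorModule C P'']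
    [SMulCommClass B Cᵐᵒᵖ P'']
    (D : Connection A P) (D' : Connection B P') (D'' : Connection C P'') :
    ((∀ (p : P) (p' : P') (p'' : P''),
        assoc A B P P' P'' (tmul _ p (tmul _ p' p'')) = tmul _ (tmul _ p p') p'') ∧
      Function.Bijective (assoc A B P P' P'') ∧
      (∀ (m n : Type) [Fintype m] [Fintype n]
        (u : Matrix m n (ModTensor A P (ModTensor B P' P''))),
        mnorm (u.map (assoc A B P P' P'')) = mnorm u) ∧
      (∀ (c : C) (t : ModTensor A P (ModTensor B P' P'')),
        assoc A B P P' P'' (MulOpposite.op c • t) = MulOpposite.op c • assoc A B P P' P'' t) ∧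
      (∀ t : ModTensor A P (ModTensor B P' P''),
        assoc A B P P' P'' (Graded.grade t) = Graded.grade (assoc A B P P' P'' t))) ∧
    Intertwines (assoc A B P P' P'').toLinearMap (completelyBounded_assoc A B P P' P'')
      (assoc_op_smul A B) (D.prod (D'.prod D'')) ((D.prod D').prod D'') := by
  exact ⟨⟨fun p p' p'' => (assoc_tmul A B p _).trans (assocBilin_tmul A B p p' p''),
    assoc_bijective A B, fun _ _ _ _ u => mnorm_assoc A B u, assoc_op_smul A B, assoc_grade A B⟩,
    Connection.intertwines_assoc D D' D''⟩
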